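/- Let $V$ be the superspace with basis $v_1,v_2,v_3,v_4$ of parities $\bar1=\bar4=0$, $\bar2=\bar3=1$ (here $\bar i\in\{0,1\}$ is the parity of $v_i$), so that $\mathfrak{osp}(V)=\mathfrak{osp}(2|2)$ with parity sequence $(\bar 0,\bar 1)$. Put $i'=5-i$, $\theta_1=\theta_2=\theta_4=1$, $\theta_3=-1$ and $\kappa=-1$. The RTT extended Yangian $X^{\mathrm{rtt}}(\mathfrak{osp}(V))$ is the associative $\mathbb C$-superalgebra generated by $t^{(r)}_{ij}$ ($1\le i,j\le 4$, $r\ge 1$), of parity $\bar i+\bar j$, subject to the following relations for the series $t_{ij}(u)=\delta_{ij}+\sum_{r\ge1}t^{(r)}_{ij}u^{-r}$ and all $1\le i,j,k,\ell\le 4$: $$[t_{ij}(u),t_{k\ell}(v)]=\frac{(-1)^{\bar i\bar j+\bar i\bar k+\bar j\bar k}}{u-v}\Big(t_{kj}(u)t_{i\ell}(v)-t_{kj}(v)t_{i\ell}(u)\Big)-\frac{1}{u-v-\kappa}\Big(\delta_{ki'}\sum_{p=1}^{4}(-1)^{\bar i+\bar i\bar j+\bar j\bar p}\theta_i\theta_p\,t_{pj}(u)t_{p'\ell}(v)-\delta_{\ell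 j'}\sum_{p=1}^{4}(-1)^{\bar i\bar k+\bar j\bar k+\bar i\bar p}\theta_{j'}\theta_{p'}\,t_{kp'}(v)t_{ip}(u)\Big).$$ This system is equivalent to the matrix relation $R(u-v)T_1(u)T_2(v)=T_2(v)T_1(u)R(u-v)$ for the rational $R$-matrix of $\mathfrak{osp}(V)$. Here and below $[x,y]=xy-(-1)^{|x||y|}yx$ is the super bracket, and an equality with denominators means the equality of formal series obtained after multiplication by these denominators. Let $T(u)=(t_{ij}(u))_{i,j=1}^4=F(u)H(u)E(u)$ be the Gauss decomposition, where $H(u)=\mathrm{diag}(h_1(u),\dots,h_4(u))$, $F(u)$ is lower unitriangular with entries $f_{ji}(u)$, and $E(u)$ is upper unitriangular with entries $e_{ij}(u)$ ($i<j$). The series $h_i(u)$ are even, and $e_{ij}(u)$, $f_{ji}(u)$ have parity $\bar i+\bar j$. Expressions such as $e_{12}(u-2)$ are expanded in powers of $u^{-1}$. Then the following relations hold in $X^{\mathrm{rtt}}(\mathfrak{osp}(V))$: $$[h_1(u),h_3(v)]=0,$$ $$[h_3(u),e_{12}(v)]=\frac{h_3(u)\big(e_{12}(u-2)-e_{12}(v)\big)}{u-v-2},\qquad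 [h_3(u),f_{21}(v)]=\frac{\big(f_{21}(v)-f_{21}(u-2)\big)h_3(u)}{u-v-2},$$ $$[h_1(u),e_{23}(v)]=0,\qquad [h_1(u),f_{32}(v)]=0,$$ $$[e_{12}(u),f_{32}(v)]=0,\qquad [e_{23}(u),f_{21}(v)]=0,$$ $$[e_{12}(u),e_{23}(v)]=\frac{2}{u-v}\Big(e_{13}(u)-e_{13}(v)-e_{12}(u)e_{23}(v)+e_{12}(v)e_{23}(v)\Big),$$ $$[f_{21}(u),f_{32}(v)]=\frac{2}{u-v}\Big(f_{31}(v)-f_{31}(u)+f_{32}(v)f_{21}(u)-f_{32}(v)f_{21}(v)\Big).$$ -/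

import Mathlib

/-! # The RTT extended Yangian of `osp(2|2)` with parity sequence `(0,1)`

Here `N = 2`, `m = 1` and `V` has the basis `v_1, v_2, v_3, v_4`.  Lean indexes it by `Fin 4`, so that
the mathematical index `i` is the Lean index `i - 1`; the involution `i' = 5 - i` is `Fin.rev`.
Series in `u⁻¹` are elements of `PowerSeries A`, the power series variable being `u⁻¹`. -/

noncomputable section

namespace OspTwoTwo

open PowerSeries

/-- The parities of `v_1, v_2, v_3, v_4`: the parity sequence is `(0,1)`, and `v_i`, `v_{i'}` have the
same parity. -/
def par : Fin 4 → ℕ := ![0, 1, 1, 0]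

/-- The parity of `t_{ij}`, `e_{ij}`, `f_{ij}` (and of `h_i`, for `j = i`), as a natural number that
matters modulo 2 only. -/
def deg (i j : Fin 4) : ℕ := par i + par j

/-- The signs `θ_i = 1` and `θ_{i'} = (-1)^{|v_i|}` for `i ≤ 2`. -/
def theta : Fin 4 → ℤ := ![1, 1, -1, 1]

/-- The constant `κ = N/2 - m - 1` for `N = 2`, `m = 1`. -/
def kappa : ℤ := -1

section Series

variable {A : Type*} [Ring A]

/-- Series in `u⁻¹` and `v⁻¹` with coefficients in `A`: the outer variable is `u⁻¹`, the inner one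
is `v⁻¹`. Both are central. -/
abbrev BiSeries (A : Type*) [Ring A] : Type _ := PowerSeries (PowerSeries A)

/-- `g ↦ g(u)`. -/
def inU (g : PowerSeries A) : BiSeries A := PowerSeries.map (PowerSeries.C (R := A)) g

/-- `g ↦ g(v)`. -/
def inV (g : PowerSeries A) : BiSeries A := PowerSeries.C g

variable (A) in
/-- The central element `u⁻¹`. -/
def uInv : BiSeries A := PowerSeries.X

variable (A) in
/-- The central element `v⁻¹`. -/
def vInv : BiSeries A := PowerSeries.C PowerSeries.X

variable (A) in
/-- The polynomial `u - v - c`, multiplied by `u⁻¹ v⁻¹`; it is not a zero divisor. -/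
def uSubV (c : ℤ) : BiSeries A := vInv A - uInv A - c • (uInv A * vInv A)

/-- The equality `L = S / (u - v - c)` of series in `u⁻¹`, `v⁻¹`, i.e. `(u - v - c) L = S`
(multiplied by `u⁻¹ v⁻¹`, in order to stay within series in `u⁻¹`, `v⁻¹`). As `u - v - c` is not
a zero divisor, `L` is determined by `S`. -/
def IsQuot (c : ℤ) (L S : BiSeries A) : Prop := uSubV A c * L = uInv A * vInv A * S

/-- The super bracket `[x, y] = x y - (-1)^{pq} y x` of elements `x`, `y` of parities `p`, `q`. -/
def superBr (p q : ℕ) (x y : BiSeries A) : BiSeries A := x * y - (-1) ^ (p * q) * (y * x)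

/-- `g ↦ g(u - c)`, expanded in `u⁻¹`: each `u^{-r}` is replaced by `(u - c)^{-r} = w ^ r` where
`w = (u - c)⁻¹ = u⁻¹ (1 + c u⁻¹ + c² u⁻² + ⋯)`. The summands with `r > n` do not contribute to the
coefficient of `u^{-n}`. -/
def shift (c : ℤ) (g : PowerSeries A) : PowerSeries A :=
  PowerSeries.mk fun n =>
    PowerSeries.coeff n (∑ r ∈ Finset.range (n + 1),
      PowerSeries.C (PowerSeries.coeff r g) *
        (PowerSeries.X * PowerSeries.mk fun k => ((c ^ k : ℤ) : A)) ^ r)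

/-- The inverse of a series in `u⁻¹` with constant term `1`. -/
def inv (g : PowerSeries A) : PowerSeries A := PowerSeries.invOfUnit g 1

/-- `t_{ij}(u) = δ_{ij} + ∑_{r ≥ 1} t_{ij}^{(r)} u^{-r}`, with `t_{ij}^{(r+1)} = g i j r`. -/
def tMat (g : Fin 4 → Fin 4 → ℕ → A) : Matrix (Fin 4) (Fin 4) (PowerSeries A) := fun i j =>
  PowerSeries.mk fun
    | 0 => if i = j then 1 else 0
    | r + 1 => g i j r

/-- The left-hand side of the `(i,j,k,l)` matrix coefficient of the RTT relation, i.e.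
`[t_{ij}(u), t_{kl}(v)]`, multiplied by `(u - v)(u - v - κ) u⁻² v⁻²`. -/
def rttLeft (T : Matrix (Fin 4) (Fin 4) (PowerSeries A)) (i j k l : Fin 4) : BiSeries A :=
  uSubV A 0 * uSubV A kappa * superBr (deg i j) (deg k l) (inU (T i j)) (inV (T k l))

/-- The right-hand side of the `(i,j,k,l)` matrix coefficient of the RTT relation,
`(-1)^{ij+ik+jk} / (u-v) * (t_{kj}(u) t_{il}(v) - t_{kj}(v) t_{il}(u))
  - 1 / (u-v-κ) * (δ_{k i'} ∑_p (-1)^{i+ij+jp} θ_i θ_p t_{pj}(u) t_{p'l}(v)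
                   - δ_{l j'} ∑_p (-1)^{ik+jk+ip} θ_{j'} θ_{p'} t_{kp'}(v) t_{ip}(u))`
(exponents of `-1` are parities of indices), multiplied by `(u - v)(u - v - κ) u⁻² v⁻²`. -/
def rttRight (T : Matrix (Fin 4) (Fin 4) (PowerSeries A)) (i j k l : Fin 4) : BiSeries A :=
  uInv A * vInv A * uSubV A kappa *
      ((-1 : ℤ) ^ (par i * par j + par i * par k + par j * par k) •
        (inU (T k j) * inV (T i l) - inV (T k j) * inU (T i l)))
    - uInv A * vInv A * uSubV A 0 *
      ((if k = i.rev then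
          ∑ p, ((-1 : ℤ) ^ (par i + par i * par j + par j * par p) * theta i * theta p) •
            (inU (T p j) * inV (T p.rev l)) else 0)
        - (if l = j.rev then
          ∑ p, ((-1 : ℤ) ^ (par i * par k + par j * par k + par i * par p)
              * theta j.rev * theta p.rev) •
            (inV (T k p.rev) * inU (T i p)) else 0))

/-- One step of Gauss elimination: subtract multiples of the row `p`, so as to clear the column
`p` (and hence also the row `p`). -/
def elimStep (p : Fin 4) (M : Matrix (Fin 4) (Fin 4) (PowerSeries A)) :
    Matrix (Fin 4) (Fin 4) (PowerSeries A) :=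
  fun i j => M i j - M i p * inv (M p p) * M p j

/-- What is left of `T` after clearing the rows and columns before the given one. -/
def reduced (T : Matrix (Fin 4) (Fin 4) (PowerSeries A)) :
    Fin 4 → Matrix (Fin 4) (Fin 4) (PowerSeries A)
  | 0 => T
  | 1 => elimStep 0 T
  | 2 => elimStep 1 (elimStep 0 T)
  | 3 => elimStep 2 (elimStep 1 (elimStep 0 T))

/-- The diagonal entries of the factor `H` in the Gauss decomposition `T = F H E`. -/
def gaussH (T : Matrix (Fin 4) (Fin 4) (PowerSeries A)) (i : Fin 4) : PowerSeries A :=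
  reduced T i i i

/-- The upper unitriangular factor `E` in the Gauss decomposition `T = F H E`. -/
def gaussE (T : Matrix (Fin 4) (Fin 4) (PowerSeries A)) :
    Matrix (Fin 4) (Fin 4) (PowerSeries A) := fun i j =>
  if i < j then inv (gaussH T i) * reduced T i i j else if i = j then 1 else 0

/-- The lower unitriangular factor `F` in the Gauss decomposition `T = F H E`. -/
def gaussF (T : Matrix (Fin 4) (Fin 4) (PowerSeries A)) :
    Matrix (Fin 4) (Fin 4) (PowerSeries A) := fun j i =>
  if i < j then reduced T i j i * inv (gaussH T i) else if j = i then 1 else 0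

theorem mul_inv_cancel_of_const {g : PowerSeries A} (hg : PowerSeries.constantCoeff g = 1) :
    g * inv g = 1 := PowerSeries.mul_invOfUnit g 1 (by simpa using hg)

theorem inv_mul_cancel_of_const {g : PowerSeries A} (hg : PowerSeries.constantCoeff g = 1) :
    inv g * g = 1 := PowerSeries.invOfUnit_mul g 1 (by simpa using hg)

/-- The entries before the given one are indeed cleared, and the others keep the constant terms of the
identity matrix. -/
theorem reduced_spec (T : Matrix (Fin 4) (Fin 4) (PowerSeries A))
    (hT : ∀ i j, PowerSeries.constantCoeff (T i j) = if i = j then 1 else 0) (p : Fin 4) :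
    (∀ i j, PowerSeries.constantCoeff (reduced T p i j) = if i = j ∧ p ≤ i then 1 else 0) ∧
    (∀ i j, i < p ∨ j < p → reduced T p i j = 0) := by
  have key : ∀ (q : Fin 4) (M : Matrix (Fin 4) (Fin 4) (PowerSeries A)),
      (∀ i j, PowerSeries.constantCoeff (M i j) = if i = j ∧ q ≤ i then 1 else 0) ∧
      (∀ i j, i < q ∨ j < q → M i j = 0) →
      (∀ i j, PowerSeries.constantCoeff (elimStep q M i j) = if i = j ∧ q < i then 1 else 0) ∧
      (∀ i j, i ≤ q ∨ j ≤ q → elimStep q M i j = 0) := by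
    rintro q M ⟨hM, h0⟩
    have hc : PowerSeries.constantCoeff (M q q) = 1 := by simp [hM]
    have h1 : PowerSeries.constantCoeff (inv (M q q)) = 1 := by simp [inv]
    constructor
    · intro i j
      simp only [elimStep, map_sub, map_mul, hM, h1]
      by_cases hiq : i = q
      · subst hiq; simp
      · have : q ≤ i ↔ q < i := ⟨fun h => lt_of_le_of_ne h (Ne.symm hiq), le_of_lt⟩
        simp [hiq, this]
    · intro i j hij
      simp only [elimStep]
      rcases hij with h | h <;> rcases h.lt_or_eq with h | h
      · simp [h0 i _ (Or.inl h)]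
      · subst h; rw [mul_inv_cancel_of_const hc]; simp
      · simp [h0 _ j (Or.inr h)]
      · subst h; rw [mul_assoc, inv_mul_cancel_of_const hc]; simp
  have r0 := key 0 T ⟨fun i j => by simp [hT], fun i j h => by simp at h⟩
  have r1 := key 1 (elimStep 0 T) ⟨fun i j => by rw [r0.1]; congr 1,
    fun i j h => r0.2 i j (by revert i j; decide)⟩
  have r2 := key 2 (elimStep 1 (elimStep 0 T))
    ⟨fun i j => by rw [r1.1]; congr 1,
    fun i j h => r1.2 i j (by revert i j; decide)⟩
  fin_cases p
  · exact ⟨fun i j => (hT i j).trans (by simp), fun i j h => by simp at h⟩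
  · exact ⟨fun i j => by
      refine (r0.1 i j).trans ?_; congr 1,
      fun i j h => r0.2 i j (by revert i j; decide)⟩
  · exact ⟨fun i j => by
      refine (r1.1 i j).trans ?_; congr 1,
      fun i j h => r1.2 i j (by revert i j; decide)⟩
  · exact ⟨fun i j => by
      refine (r2.1 i j).trans ?_; congr 1,
      fun i j h => r2.2 i j (by revert i j; decide)⟩

/-- The matrices above do form the Gauss decomposition of `T`. -/
theorem gauss_decomposition (T : Matrix (Fin 4) (Fin 4) (PowerSeries A))
    (hT : ∀ i j, PowerSeries.constantCoeff (T i j) = if i = j then 1 else 0) :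
    T = gaussF T * Matrix.diagonal (gaussH T) * gaussE T := by
  have hs := reduced_spec T hT
  have hc : ∀ p, PowerSeries.constantCoeff (gaussH T p) = 1 := fun p => by
    simp [gaussH, (hs p).1]
  have term : ∀ p i j, gaussF T i p * gaussH T p * gaussE T p j
      = reduced T p i p * inv (gaussH T p) * reduced T p p j := by
    intro p i j
    have e1 : gaussF T i p * gaussH T p = reduced T p i p := by
      unfold gaussF
      split_ifs with h1 h2
      · rw [mul_assoc, inv_mul_cancel_of_const (hc p), mul_one]
      · subst h2; simp [gaussH]
      · rw [(hs p).2 i p (Or.inl (lt_of_le_of_ne (not_lt.mp h1) h2)), zero_mul]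
    have e2 : gaussE T p j = inv (gaussH T p) * reduced T p p j := by
      unfold gaussE
      split_ifs with h1 h2
      · rfl
      · subst h2; exact (inv_mul_cancel_of_const (hc p)).symm
      · rw [(hs p).2 p j (Or.inr (lt_of_le_of_ne (not_lt.mp h1) (Ne.symm h2))), mul_zero]
    rw [e1, e2, mul_assoc]
  have last : ∀ i j, reduced T 3 i j
      = reduced T 3 i 3 * inv (gaussH T 3) * reduced T 3 3 j := by
    intro i j
    by_cases hi : i = 3
    · subst hi
      rw [show reduced T 3 3 3 = gaussH T 3 from rfl, mul_inv_cancel_of_const (hc 3), one_mul]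
    · have hi' : i < 3 := by revert i; decide
      rw [(hs 3).2 i j (Or.inl hi'), (hs 3).2 i 3 (Or.inl hi')]; simp
  ext1 i j
  rw [Matrix.mul_apply]
  simp only [Matrix.mul_diagonal, term, Fin.sum_univ_four]
  rw [← last]
  simp [reduced, elimStep, gaussH]

/-- The Gauss decomposition is unique. -/
theorem gauss_unique (T F E : Matrix (Fin 4) (Fin 4) (PowerSeries A)) (H : Fin 4 → PowerSeries A)
    (hF1 : ∀ i, F i i = 1) (hF0 : ∀ i j, i < j → F i j = 0)
    (hE1 : ∀ i, E i i = 1) (hE0 : ∀ i j, j < i → E i j = 0)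
    (hH : ∀ i, PowerSeries.constantCoeff (H i) = 1) (hT : T = F * Matrix.diagonal H * E) :
    H = gaussH T ∧ F = gaussF T ∧ E = gaussE T := by
  have red : ∀ p i j, reduced T p i j = ∑ q, if p ≤ q then F i q * H q * E q j else 0 := by
    have step : ∀ (p : Fin 4) (M : Matrix (Fin 4) (Fin 4) (PowerSeries A)),
        (∀ i j, M i j = ∑ q, if p ≤ q then F i q * H q * E q j else 0) →
        ∀ i j, elimStep p M i j = ∑ q, if p < q then F i q * H q * E q j else 0 := by
      intro p M hM i j
      have a1 : ∀ i, M i p = F i p * H p := by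
        intro i
        rw [hM, Finset.sum_eq_single p]
        · simp [hE1]
        · intro q _ hq
          split_ifs with h
          · rw [hE0 q p (lt_of_le_of_ne h (Ne.symm hq)), mul_zero]
          · rfl
        · simp
      have a2 : ∀ j, M p j = H p * E p j := by
        intro j
        rw [hM, Finset.sum_eq_single p]
        · simp [hF1]
        · intro q _ hq
          split_ifs with h
          · rw [hF0 p q (lt_of_le_of_ne h (Ne.symm hq))]; simp
          · rfl
        · simp
      have a3 : M p p = H p := by rw [a1, hF1, one_mul]
      have a4 : M i p * inv (M p p) * M p j = F i p * H p * E p j := by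
        rw [a3, a1, a2, mul_assoc (F i p), mul_inv_cancel_of_const (hH p), mul_one, mul_assoc]
      rw [elimStep, a4, hM, sub_eq_iff_eq_add,
        ← Finset.add_sum_erase _ _ (Finset.mem_univ p), if_pos le_rfl,
        ← Finset.add_sum_erase _ (fun q => if p < q then F i q * H q * E q j else 0)
          (Finset.mem_univ p), if_neg (lt_irrefl p), zero_add, add_comm]
      congr 1
      refine Finset.sum_congr rfl fun q hq => ?_
      have : p ≤ q ↔ p < q :=
        ⟨fun h => lt_of_le_of_ne h (Ne.symm (Finset.ne_of_mem_erase hq)), le_of_lt⟩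
      simp [this]
    have s0 := step 0 T fun i j => by
      rw [hT, Matrix.mul_apply]; simp [Matrix.mul_diagonal]
    have s1 := step 1 (elimStep 0 T) fun i j => by
      rw [s0]; exact Finset.sum_congr rfl fun q _ => if_congr (by revert q; decide) rfl rfl
    have s2 := step 2 (elimStep 1 (elimStep 0 T)) fun i j => by
      rw [s1]; exact Finset.sum_congr rfl fun q _ => if_congr (by revert q; decide) rfl rfl
    intro p i j
    fin_cases p
    · change T i j = _
      rw [hT, Matrix.mul_apply]; simp [Matrix.mul_diagonal]
    · exact (s0 i j).trans
        (Finset.sum_congr rfl fun q _ => if_congr (by revert q; decide) rfl rfl)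
    · exact (s1 i j).trans
        (Finset.sum_congr rfl fun q _ => if_congr (by revert q; decide) rfl rfl)
    · exact (s2 i j).trans
        (Finset.sum_congr rfl fun q _ => if_congr (by revert q; decide) rfl rfl)
  have col : ∀ p i, reduced T p i p = F i p * H p := by
    intro p i
    rw [red, Finset.sum_eq_single p]
    · simp [hE1]
    · intro q _ hq
      split_ifs with h
      · rw [hE0 q p (lt_of_le_of_ne h (Ne.symm hq)), mul_zero]
      · rfl
    · simp
  have row : ∀ p j, reduced T p p j = H p * E p j := by
    intro p j
    rw [red, Finset.sum_eq_single p]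
    · simp [hF1]
    · intro q _ hq
      split_ifs with h
      · rw [hF0 p q (lt_of_le_of_ne h (Ne.symm hq))]; simp
      · rfl
    · simp
  have hh : ∀ p, gaussH T p = H p := fun p => by rw [gaussH, col, hF1, one_mul]
  refine ⟨funext fun p => (hh p).symm, ?_, ?_⟩
  · ext1 j i
    unfold gaussF
    split_ifs with h1 h2
    · rw [col, hh, mul_assoc, mul_inv_cancel_of_const (hH i), mul_one]
    · rw [h2, hF1]
    · exact hF0 j i (lt_of_le_of_ne (not_lt.mp h1) h2)
  · ext1 i j
    unfold gaussE
    split_ifs with h1 h2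
    · rw [row, hh, ← mul_assoc, inv_mul_cancel_of_const (hH i), one_mul]
    · rw [h2, hE1]
    · exact hE0 i j (lt_of_le_of_ne (not_lt.mp h1) (Ne.symm h2))

end Series

/-- The defining relations of the RTT extended Yangian, as a relation on the free algebra: the
coefficients of the RTT relation are equated. -/
inductive Rel : FreeAlgebra ℂ (Fin 4 × Fin 4 × ℕ) → FreeAlgebra ℂ (Fin 4 × Fin 4 × ℕ) → Prop
  | rtt (i j k l : Fin 4) (a b : ℕ) :
      Rel
        (PowerSeries.coeff b (PowerSeries.coeff a
          (rttLeft (tMat fun i j r => FreeAlgebra.ι ℂ (i, j, r)) i j k l)))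
        (PowerSeries.coeff b (PowerSeries.coeff a
          (rttRight (tMat fun i j r => FreeAlgebra.ι ℂ (i, j, r)) i j k l)))

/-- The RTT extended Yangian of `osp(2|2)` with parity sequence `(0,1)`: the associative
`ℂ`-algebra generated by `t_{ij}^{(r)}`, `r ≥ 1`, subject to the RTT relation. -/
abbrev Yangian : Type := RingQuot Rel

/-- The generator `t_{ij}^{(r+1)}`, of parity `deg i j`. -/
def gen (i j : Fin 4) (r : ℕ) : Yangian :=
  RingQuot.mkAlgHom ℂ Rel (FreeAlgebra.ι ℂ (i, j, r))

/-- The matrix `T(u) = (t_{ij}(u))` over the Yangian. -/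
def T : Matrix (Fin 4) (Fin 4) (PowerSeries Yangian) := tMat gen

/-- `h_1(u), …, h_4(u)` are `h 0, …, h 3`. -/
def h (i : Fin 4) : PowerSeries Yangian := gaussH T i

/-- `e_{ij}(u)`, for `i < j`, is `e (i-1) (j-1)`. -/
def e (i j : Fin 4) : PowerSeries Yangian := gaussE T i j

/-- `f_{ji}(u)`, for `i < j`, is `f (j-1) (i-1)`. -/
def f (j i : Fin 4) : PowerSeries Yangian := gaussF T j i

/-- `T(u) = F(u) H(u) E(u)`. -/
theorem T_eq : T = Matrix.of f * Matrix.diagonal h * Matrix.of e := by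
  refine gauss_decomposition T fun i j => ?_
  rw [← PowerSeries.coeff_zero_eq_constantCoeff_apply]
  simp [T, tMat]

end OspTwoTwo

end

open OspTwoTwo

/-! Write `D` for u - v and `q` for 1, both multiplied by u⁻¹v⁻¹. Then u - v - κ is `D + q`, and no
`D + c • q` is a zero divisor. Indices are 1, …, 4 in these comments and shifted by one in the code.
Every bracket in the theorem has at least one even argument, so it is an ordinary commutator. The
relations of t_11(u) and t_12(u) with all t_kl(v) suffice for the h- and e-statements and for [e_12,
f_32].

When the correction terms with denominator u - v - κ are absent, these relations are of gl type. The
classical argument then applies: h_1(u) = t_11(u) commutes with the Schur complements t_mn - t_m1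
h_1⁻¹ t_1n at v (`commute_schur`), hence with h_2, e_23, f_32 and h_3. The brackets of e_12(u) with
h_2(v) and f_32(v)h_2(v) have the same shape (`bracket_schur_left`), which forces [e_12(u), f_32(v)]
= 0.

For h_3 and e_23 against e_12 one works with the inverse N = T(v)⁻¹ = E⁻¹H⁻¹F⁻¹. Conjugating the
relations by N contracts most terms to Kronecker deltas (`bracket_inverse`). Eliminating the last
row and column of N leaves h_3⁻¹, -e_23 h_3⁻¹ and (e_12 e_23 - e_13) h_3⁻¹ in its third column. The
resulting brackets with e_12(u) still contain unknown series in v alone. Specialization removes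
these: if (u - v + c) L = M, then M vanishes at u = v - c. With c = 2 this identifies the unknown
series as e_12(v - 2), and with c = 1 it shows that the remainder in [e_12, e_23] is zero.

The other relations follow by applying the same results to the signed transpose of T over the
opposite algebra, which exchanges E and F (`IsRTTPair.twist_row`), and by exchanging u and v where
needed. -/

noncomputable section

namespace OspTwoTwo

/-! ### Series in two variables: cancellation, exchange of variables, specialization u = v - c. -/

section Series

variable {A : Type*} [Ring A]

/-- `inU` as a ring homomorphism. -/
def inUHom (A : Type*) [Ring A] : PowerSeries A →+* BiSeries A := PowerSeries.map PowerSeries.C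

/-- `inV` as a ring homomorphism. -/
def inVHom (A : Type*) [Ring A] : PowerSeries A →+* BiSeries A := PowerSeries.C

theorem inU_eq_inUHom (g : PowerSeries A) : inU g = inUHom A g := rfl

theorem inV_eq_inVHom (g : PowerSeries A) : inV g = inVHom A g := rfl

theorem uInv_mul_comm (G : BiSeries A) : uInv A * G = G * uInv A :=
  (PowerSeries.commute_X G).symm

theorem vInv_mul_comm (G : BiSeries A) : vInv A * G = G * vInv A := by
  refine PowerSeries.ext fun n => ?_
  rw [vInv, PowerSeries.coeff_C_mul, PowerSeries.coeff_mul_C]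
  exact (PowerSeries.commute_X _).symm

/-- Writing G_n for the coefficient of u⁻ⁿ, the hypothesis reads v⁻¹ G_n = (1 + c v⁻¹) G_{n-1}.
Induction on n applies because v⁻¹ is not a zero divisor. -/
theorem uSubV_mul_eq_zero {c : ℤ} {G : BiSeries A} (hG : uSubV A c * G = 0) : G = 0 := by
  have key : ∀ n, PowerSeries.X * PowerSeries.coeff n G = 0 → PowerSeries.coeff n G = 0 := by
    intro n hn
    refine PowerSeries.ext fun m => ?_
    have := congrArg (PowerSeries.coeff (m + 1)) hn
    simpa [PowerSeries.coeff_succ_X_mul] using this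
  have expand : uSubV A c * G
      = vInv A * G - uInv A * G - c • (uInv A * (vInv A * G)) := by
    simp only [uSubV, sub_mul, smul_mul_assoc, mul_assoc]
  rw [expand] at hG
  refine PowerSeries.ext fun n => ?_
  induction n with
  | zero =>
    refine key 0 ?_
    have := congrArg (PowerSeries.coeff 0) hG
    simpa [uInv, vInv, PowerSeries.coeff_zero_X_mul, PowerSeries.coeff_C_mul] using this
  | succ n ih =>
    refine key (n + 1) ?_
    have := congrArg (PowerSeries.coeff (n + 1)) hG
    simp only [map_sub, map_zsmul, uInv, vInv, PowerSeries.coeff_succ_X_mul,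
      PowerSeries.coeff_C_mul, ih] at this
    simpa using this

/-- Exchanging the two variables. -/
def swap (A : Type*) [Ring A] : BiSeries A →+* BiSeries A where
  toFun G := PowerSeries.mk fun a => PowerSeries.mk fun b =>
    PowerSeries.coeff a (PowerSeries.coeff b G)
  map_one' := by
    refine PowerSeries.ext fun a => PowerSeries.ext fun b => ?_
    simp only [PowerSeries.coeff_mk, PowerSeries.coeff_one]
    split_ifs <;> simp_all [PowerSeries.coeff_one]
  map_mul' G G' := by
    refine PowerSeries.ext fun a => PowerSeries.ext fun b => ?_
    simp only [PowerSeries.coeff_mk, PowerSeries.coeff_mul, map_sum]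
    exact Finset.sum_comm
  map_zero' := by
    refine PowerSeries.ext fun a => PowerSeries.ext fun b => ?_
    simp
  map_add' G G' := by
    refine PowerSeries.ext fun a => PowerSeries.ext fun b => ?_
    simp

theorem coeff_swap (G : BiSeries A) (a b : ℕ) :
    PowerSeries.coeff b (PowerSeries.coeff a (swap A G))
      = PowerSeries.coeff a (PowerSeries.coeff b G) := by
  simp [swap]

theorem coeff_inU (g : PowerSeries A) (a b : ℕ) :
    PowerSeries.coeff b (PowerSeries.coeff a (inU g))
      = if b = 0 then PowerSeries.coeff a g else 0 := by
  simp [inU, PowerSeries.coeff_C]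

theorem coeff_inV (g : PowerSeries A) (a b : ℕ) :
    PowerSeries.coeff b (PowerSeries.coeff a (inV g))
      = if a = 0 then PowerSeries.coeff b g else 0 := by
  rw [inV, PowerSeries.coeff_C]
  split_ifs <;> simp

@[simp]
theorem swap_inU (g : PowerSeries A) : swap A (inU g) = inV g := by
  refine PowerSeries.ext fun a => PowerSeries.ext fun b => ?_
  rw [coeff_swap, coeff_inU, coeff_inV]

@[simp]
theorem swap_inV (g : PowerSeries A) : swap A (inV g) = inU g := by
  refine PowerSeries.ext fun a => PowerSeries.ext fun b => ?_
  rw [coeff_swap, coeff_inU, coeff_inV]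

theorem uInv_eq : uInv A = inU PowerSeries.X := by
  simp [uInv, inU]

theorem vInv_eq : vInv A = inV PowerSeries.X := rfl

@[simp]
theorem swap_uInv : swap A (uInv A) = vInv A := by rw [uInv_eq, swap_inU, vInv_eq]

@[simp]
theorem swap_vInv : swap A (vInv A) = uInv A := by rw [uInv_eq, vInv_eq, swap_inV]

theorem swap_uSubV (c : ℤ) : swap A (uSubV A c) = -uSubV A (-c) := by
  simp only [uSubV, map_sub, map_zsmul, map_mul, swap_uInv, swap_vInv, neg_smul,
    ← uInv_mul_comm (vInv A)]
  abel

/-- The expansion of `(u - c)⁻¹` in `u⁻¹`. -/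
def shiftInv (A : Type*) [Ring A] (c : ℤ) : PowerSeries A :=
  PowerSeries.X * PowerSeries.mk fun k => ((c ^ k : ℤ) : A)

theorem shiftInv_mul (c : ℤ) :
    shiftInv A c * (1 - c • PowerSeries.X) = PowerSeries.X := by
  rw [shiftInv, mul_assoc]
  conv_rhs => rw [← mul_one PowerSeries.X]
  congr 1
  refine PowerSeries.ext fun n => ?_
  rw [mul_sub, mul_one, mul_smul_comm, map_sub, map_zsmul]
  cases n with
  | zero => simp
  | succ n =>
    rw [PowerSeries.coeff_succ_mul_X, PowerSeries.coeff_mk, PowerSeries.coeff_mk,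
      PowerSeries.coeff_one, if_neg n.succ_ne_zero, pow_succ', Int.cast_mul, zsmul_eq_mul, sub_self]

theorem shiftInv_commute (c : ℤ) (g : PowerSeries A) : Commute (shiftInv A c) g := by
  refine Commute.mul_left (PowerSeries.commute_X g).symm ?_
  refine PowerSeries.ext fun n => ?_
  rw [PowerSeries.coeff_mul, PowerSeries.coeff_mul, ← Finset.Nat.sum_antidiagonal_swap]
  refine Finset.sum_congr rfl fun p _ => ?_
  rw [PowerSeries.coeff_mk, PowerSeries.coeff_mk]
  exact (Int.cast_commute (c ^ p.2) (PowerSeries.coeff p.1 g)).eq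

theorem coeff_mul_shiftInv_pow {c : ℤ} {n r : ℕ} (h : n < r) (g : PowerSeries A) :
    PowerSeries.coeff n (g * shiftInv A c ^ r) = 0 := by
  have h1 : g * shiftInv A c ^ r
      = PowerSeries.X ^ r * (g * (PowerSeries.mk fun k => ((c ^ k : ℤ) : A)) ^ r) := by
    rw [shiftInv, (PowerSeries.commute_X _).symm.mul_pow, ← mul_assoc, ← mul_assoc,
      ((PowerSeries.commute_X g).pow_right r).eq]
  rw [h1, PowerSeries.coeff_X_pow_mul', if_neg (not_le.mpr h)]

/-- The substitution `u = v - c`, as an additive map. -/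
def spec (c : ℤ) : BiSeries A →+ PowerSeries A where
  toFun G := PowerSeries.mk fun n =>
    PowerSeries.coeff n (∑ r ∈ Finset.range (n + 1), PowerSeries.coeff r G * shiftInv A c ^ r)
  map_zero' := by
    refine PowerSeries.ext fun n => ?_
    simp
  map_add' G G' := by
    refine PowerSeries.ext fun n => ?_
    simp [add_mul, Finset.sum_add_distrib]

/-- The r-th summand is divisible by v⁻ʳ, so any truncation beyond n gives the same coefficient.
This freedom allows sums of different lengths to be compared below. -/
theorem coeff_spec {c : ℤ} (G : BiSeries A) {n N : ℕ} (h : n < N) :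
    PowerSeries.coeff n (spec c G)
      = PowerSeries.coeff n
          (∑ r ∈ Finset.range N, PowerSeries.coeff r G * shiftInv A c ^ r) := by
  have : PowerSeries.coeff n (spec c G) = PowerSeries.coeff n
      (∑ r ∈ Finset.range (n + 1), PowerSeries.coeff r G * shiftInv A c ^ r) := by
    simp only [spec, AddMonoidHom.coe_mk, ZeroHom.coe_mk, PowerSeries.coeff_mk]
  rw [this, map_sum, map_sum]
  refine Finset.sum_subset (Finset.range_subset_range.mpr h) fun r _ hr => ?_
  exact coeff_mul_shiftInv_pow (by simpa using hr) _

theorem spec_inU (c : ℤ) (g : PowerSeries A) : spec c (inU g) = shift c g := by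
  refine PowerSeries.ext fun n => ?_
  simp [spec, shift, inU, shiftInv]

theorem spec_inV (c : ℤ) (g : PowerSeries A) : spec c (inV g) = g := by
  refine PowerSeries.ext fun n => ?_
  rw [coeff_spec _ n.lt_succ_self, Finset.sum_eq_single 0]
  · simp [inV]
  · intro r _ hr
    simp [inV, PowerSeries.coeff_C, hr]
  · simp

theorem spec_vInv_mul (c : ℤ) (G : BiSeries A) :
    spec c (vInv A * G) = PowerSeries.X * spec c G := by
  refine PowerSeries.ext fun n => ?_
  cases n with
  | zero =>
    rw [coeff_spec _ (Nat.lt_succ_self _)]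
    simp [vInv, PowerSeries.coeff_C_mul]
  | succ n =>
    rw [PowerSeries.coeff_succ_X_mul, coeff_spec G (n.lt_succ_self.trans (Nat.lt_succ_self _)),
      coeff_spec (vInv A * G) (Nat.lt_succ_self _)]
    conv_rhs => rw [← PowerSeries.coeff_succ_X_mul, Finset.mul_sum]
    simp only [vInv, PowerSeries.coeff_C_mul, mul_assoc]

theorem spec_uInv_mul (c : ℤ) (G : BiSeries A) :
    spec c (uInv A * G) = shiftInv A c * spec c G := by
  refine PowerSeries.ext fun n => ?_
  have h1 : PowerSeries.coeff n (shiftInv A c * spec c G) = PowerSeries.coeff n (shiftInv A c *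
      ∑ r ∈ Finset.range (n + 1), PowerSeries.coeff r G * shiftInv A c ^ r) := by
    rw [PowerSeries.coeff_mul, PowerSeries.coeff_mul]
    refine Finset.sum_congr rfl fun p hp => ?_
    rw [coeff_spec G (show p.2 < n + 1 by have := Finset.HasAntidiagonal.mem_antidiagonal.mp hp; omega)]
  rw [h1, coeff_spec _ (n.lt_succ_self.trans (Nat.lt_succ_self _)), Finset.sum_range_succ',
    Finset.mul_sum]
  congr 1
  rw [uInv, PowerSeries.coeff_zero_X_mul, zero_mul, add_zero]
  refine Finset.sum_congr rfl fun r _ => ?_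
  rw [PowerSeries.coeff_succ_X_mul, pow_succ', ← mul_assoc, ← mul_assoc,
    (shiftInv_commute c _).eq]

theorem shiftInv_mul_eq_zero {c : ℤ} {g : PowerSeries A} (h : shiftInv A c * g = 0) : g = 0 := by
  have h1 : PowerSeries.X * g = 0 := by
    rw [← shiftInv_mul c, (shiftInv_commute c _).eq, mul_assoc, h, mul_zero]
  refine PowerSeries.ext fun n => ?_
  simpa [PowerSeries.coeff_succ_X_mul] using congrArg (PowerSeries.coeff (n + 1)) h1

theorem X_mul_eq_zero {g : PowerSeries A} (h : PowerSeries.X * g = 0) : g = 0 := by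
  refine PowerSeries.ext fun n => ?_
  simpa [PowerSeries.coeff_succ_X_mul] using congrArg (PowerSeries.coeff (n + 1)) h

/-- The factor is u - v + c up to u⁻¹v⁻¹. It vanishes at u⁻¹ = (v - c)⁻¹, which is exactly
`shiftInv_mul`. -/
theorem spec_uSubV_mul (c : ℤ) (G : BiSeries A) : spec c (uSubV A (-c) * G) = 0 := by
  have expand : uSubV A (-c) * G
      = vInv A * G - uInv A * G + c • (uInv A * (vInv A * G)) := by
    simp only [uSubV, sub_mul, add_mul, smul_mul_assoc, mul_assoc, neg_smul, sub_neg_eq_add]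
  rw [expand, map_add, map_sub, map_zsmul, spec_uInv_mul, spec_uInv_mul, spec_vInv_mul]
  have h := shiftInv_mul (A := A) c
  rw [mul_sub, mul_one, mul_smul_comm] at h
  rw [← mul_assoc, ← smul_mul_assoc, ← sub_mul, ← add_mul]
  conv_lhs => enter [1, 1, 1]; rw [← h]
  simp

/-- Over `u - v + c` only multiples of `u - v + c` vanish after the substitution `u = v - c`. -/
theorem spec_eq_zero {c : ℤ} {L M : BiSeries A} (h : uSubV A (-c) * L = uInv A * vInv A * M) :
    spec c M = 0 := by
  have := spec_uSubV_mul c L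
  rw [h, mul_assoc, spec_uInv_mul, spec_vInv_mul] at this
  exact X_mul_eq_zero (shiftInv_mul_eq_zero this)

end Series

/-! ### Noncommutative identities for brackets with Schur complements. -/

section Schur

variable {R S : Type*} [CommRing R] [Ring S] [Algebra R S]

/-- The product rule expands the bracket with `bm * h' * bn`. Since `a` commutes with `h'`, the
terms coming from `h1` and `h2` cancel those of `h3`. -/
theorem commute_schur (D q : R) {a h h' bm am bn an t : S}
    (h1 : D • (a * bm - bm * a) = q • (am * h - bm * a))
    (h2 : D • (a * bn - bn * a) = q • (a * bn - h * an))
    (h3 : D • (a * t - t * a) = q • (am * bn - bm * an))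
    (hc : a * h' = h' * a) (hh : h * h' = 1) (hh' : h' * h = 1) :
    D • (a * (t - bm * h' * bn) - (t - bm * h' * bn) * a) = 0 := by
  linear_combination (norm := (simp only [mul_sub, sub_mul, smul_mul_assoc,
    mul_smul_comm, mul_assoc, mul_one]; module))
    h3 - h1 * (h' * bn) - (bm * h') * h2 - D • (bm * hc * bn) - q • (am * hh * bn)
      + q • (bm * hc * bn) + q • (bm * hh' * an)

/-- Intended for a = t_12(u), a₀ = t_11(u) and entries of T(v), with pivot h = t_11(v). The terms in
`am` cancel and the Schur complement factors out on the left. -/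
theorem bracket_schur_left (D q : R) {a a₀ h h' b bm am t : S}
    (h1 : D • (a * t - t * a) = -q • (am * b - t * a))
    (h2 : D • (a * bm + bm * a) = -q • (am * h - t * a₀))
    (h3 : D • (a * b + b * a) = q • (a * b - b * a))
    (h4 : D • (a * h - h * a) = q • (a * h - b * a₀))
    (hh : h * h' = 1) (hh' : h' * h = 1) :
    D • (a * (t - bm * h' * b) - (t - bm * h' * b) * a)
      = q • ((t - bm * h' * b) * (a - a₀ * (h' * b))) := by
  linear_combination (norm := (simp only [mul_sub, sub_mul, mul_add, add_mul, smul_mul_assoc,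
    mul_smul_comm, mul_assoc, mul_one]; module))
    h1 - h2 * (h' * b) + (bm * h') * h3 - (bm * h') * h4 * (h' * b)
      + D • ((bm * h' * a) * hh * b) - D • (bm * hh' * (a * h' * b))
      + q • (am * hh * b) - q • ((bm * h' * a) * hh * b)

/-- The counterpart for entries of T(v)⁻¹, with pivot `p₄` in the last corner and inverse `w`. The
terms `P₂`, `P₃` stand for the gl part that survives contraction. -/
theorem bracket_schur_right (K α β : R) {a b p p₄ p₄₃ t w z c g₂ g₃ P₂ P₃ : S}
    (h1 : K • (b * t - t * b) = -α • P₂ + β • (p * c - z * g₂))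
    (h2 : K • (b * p + p * b) = -α • P₃ + β • (-(p * b) - z * g₃))
    (h3 : K • (b * p₄₃ + p₄₃ * b) = β • (a * g₂ - p₄ * c))
    (h4 : K • (b * p₄ - p₄ * b) = β • (p₄ * b + a * g₃))
    (hw : p₄ * w = 1) (hw' : w * p₄ = 1) :
    K • (b * (t - p * w * p₄₃) - (t - p * w * p₄₃) * b)
      = -α • (P₂ - P₃ * w * p₄₃) - β • ((z - p * w * a) * (g₂ - g₃ * w * p₄₃)) := by
  linear_combination (norm := (simp only [mul_sub, sub_mul, mul_add, add_mul, smul_mul_assoc,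
    mul_smul_comm, mul_assoc, mul_one, neg_mul]; module))
    h1 - h2 * (w * p₄₃) + (p * w) * h3 - (p * w) * h4 * (w * p₄₃)
      + K • ((p * w * b) * hw * p₄₃) - K • (p * hw' * (b * w * p₄₃))
      - β • (p * hw' * c) - β • (p * hw' * (b * w * p₄₃))

/-- Passing from a bracket with `b = a x` to a bracket with `x`, where `a` commutes with `s`, and
`a` and `v` satisfy a relation of the same kind. -/
theorem bracket_of_bracket_mul (D q : R) (hc : ∀ z : S, (D + q) • z = 0 → z = 0)
    {a a' x s Q z v G : S} (haa : a' * a = 1) (has : a * s = s * a)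
    (h : (D * (D + q)) • (a * x * s - s * (a * x))
      = -(q * (D + q)) • (a * Q) - (q * D) • ((a * z - v * a) * G))
    (hv : (D + q) • (a * v - v * a) = q • (v * a - a * z)) :
    (D * (D + 2 * q)) • (x * s - s * x)
      = -(q * (D + 2 * q)) • Q - (q * D) • ((z - v) * G) := by
  rw [← sub_eq_zero]
  refine hc _ ?_
  -- By `hv`, (D + 2q)(az - va) = (D + q) a(z - v). This is how the factor D + 2q arises, and it
  -- lets `a` be cancelled on the left.
  have key : (D + q) • (a * ((D * (D + 2 * q)) • (x * s - s * x)
      - (-(q * (D + 2 * q)) • Q - (q * D) • ((z - v) * G)))) = 0 := by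
    linear_combination (norm := (simp only [mul_sub, sub_mul, mul_add, add_mul, smul_mul_assoc,
      mul_smul_comm, mul_assoc]; module))
      (D + 2 * q) • h - (q * D) • (hv * G) - (D * (D + q) * (D + 2 * q)) • (has * x)
  have := congrArg (a' * ·) key
  simpa only [mul_smul_comm, ← mul_assoc, haa, one_mul, mul_zero] using this

end Schur

/-! ### Brackets with the entries of an inverse matrix. -/

section Cross

variable {R S : Type*} [CommRing R] [Ring S] [Algebra R S]

/-- The `(k, l)` entry of `J B J X B`, up to sign, where `J` is the diagonal matrix of the
signs `s`. -/
def conjSum (s : Fin 4 → ℤ) (B : Matrix (Fin 4) (Fin 4) S) (k l : Fin 4)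
    (X : Fin 4 → Fin 4 → S) : S :=
  ∑ m, ∑ n, (s k * s m) • (B k m * X m n * B n l)

theorem conjSum_add (s : Fin 4 → ℤ) (B : Matrix (Fin 4) (Fin 4) S) (k l : Fin 4)
    (X Y : Fin 4 → Fin 4 → S) :
    conjSum s B k l (fun m n => X m n + Y m n) = conjSum s B k l X + conjSum s B k l Y := by
  simp only [conjSum, mul_add, add_mul, smul_add, Finset.sum_add_distrib]

theorem conjSum_sub (s : Fin 4 → ℤ) (B : Matrix (Fin 4) (Fin 4) S) (k l : Fin 4)
    (X Y : Fin 4 → Fin 4 → S) :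
    conjSum s B k l (fun m n => X m n - Y m n) = conjSum s B k l X - conjSum s B k l Y := by
  simp only [conjSum, mul_sub, sub_mul, smul_sub, Finset.sum_sub_distrib]

theorem conjSum_smul (s : Fin 4 → ℤ) (B : Matrix (Fin 4) (Fin 4) S) (k l : Fin 4) (c : R)
    (X : Fin 4 → Fin 4 → S) :
    conjSum s B k l (fun m n => c • X m n) = c • conjSum s B k l X := by
  simp only [conjSum, mul_smul_comm, smul_mul_assoc, Finset.smul_sum]
  simp only [smul_comm c]

theorem conjSum_mul (s : Fin 4 → ℤ) (B : Matrix (Fin 4) (Fin 4) S) (k l : Fin 4)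
    (x y : Fin 4 → S) :
    conjSum s B k l (fun m n => x m * y n)
      = (∑ m, (s k * s m) • (B k m * x m)) * ∑ n, y n * B n l := by
  simp only [conjSum, Finset.sum_mul_sum, smul_mul_assoc, mul_assoc]

/-- This is [a, B⁻¹] = -B⁻¹ [a, B] B⁻¹, with signs `s` recording the parities. -/
theorem bracket_inverse {B B' : Matrix (Fin 4) (Fin 4) S} (h1 : B * B' = 1) (h2 : B' * B = 1)
    {s : Fin 4 → ℤ} (hs : ∀ m, s m * s m = 1) (c : R) (a : S) (X : Fin 4 → Fin 4 → S)
    (h : ∀ m n, c • (a * B m n - (s m * s n) • (B m n * a)) = X m n) (k l : Fin 4) :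
    c • (a * B' k l - (s k * s l) • (B' k l * a)) = -conjSum s B' k l X := by
  have e1 : ∀ p, ∑ n, B p n * B' n l = if p = l then 1 else 0 := fun p => by
    rw [← Matrix.mul_apply, h1, Matrix.one_apply]
  have e2 : ∀ p, ∑ m, B' k m * B m p = if k = p then 1 else 0 := fun p => by
    rw [← Matrix.mul_apply, h2, Matrix.one_apply]
  have s1 : ∑ m, ∑ n, (s k * s m) • (B' k m * (a * B m n) * B' n l)
      = (s k * s l) • (B' k l * a) := by
    have : ∀ m, ∑ n, (s k * s m) • (B' k m * (a * B m n) * B' n l)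
        = if m = l then (s k * s m) • (B' k m * a) else 0 := fun m => by
      rw [← Finset.smul_sum]
      simp only [mul_assoc]
      rw [← Finset.mul_sum, ← Finset.mul_sum, e1]
      split_ifs <;> simp
    simp only [this, Finset.sum_ite_eq', Finset.mem_univ, if_true]
  have s2 : ∑ m, ∑ n, (s k * s m) • (B' k m * ((s m * s n) • (B m n * a)) * B' n l)
      = a * B' k l := by
    rw [Finset.sum_comm]
    have : ∀ n, ∑ m, (s k * s m) • (B' k m * ((s m * s n) • (B m n * a)) * B' n l)
        = if k = n then (s k * s n) • (a * B' n l) else 0 := fun n => by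
      have : ∀ m, (s k * s m) • (B' k m * ((s m * s n) • (B m n * a)) * B' n l)
          = (s k * s n) • ((B' k m * B m n) * (a * B' n l)) := fun m => by
        rw [mul_smul_comm, smul_mul_assoc, smul_smul,
          show s k * s m * (s m * s n) = s k * (s m * s m) * s n by ring, hs, mul_one]
        simp only [mul_assoc]
      simp only [this]
      rw [← Finset.smul_sum, ← Finset.sum_mul, e2]
      split_ifs <;> simp
    simp only [this, Finset.sum_ite_eq, Finset.mem_univ, if_true, hs, one_smul]
  have : conjSum s B' k l X = c • ((s k * s l) • (B' k l * a) - a * B' k l) := by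
    rw [← s1, ← s2]
    simp only [← Finset.sum_sub_distrib, Finset.smul_sum, conjSum, ← h]
    refine Finset.sum_congr rfl fun m _ => Finset.sum_congr rfl fun n _ => ?_
    rw [mul_smul_comm, smul_mul_assoc, smul_comm, mul_sub, sub_mul, smul_sub]
  rw [this, ← smul_neg, neg_sub]

end Cross

/-- The signs `(-1)^{|v_i|}`. -/
def sgn : Fin 4 → ℤ := ![1, -1, -1, 1]

theorem sgn_mul_self (m : Fin 4) : sgn m * sgn m = 1 := by revert m; decide

/-! ### Relations of t_11(u) and t_12(u) with T(v) and with its inverse. -/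

section Row

variable {R S : Type*} [CommRing R] [Ring S] [Algebra R S]

/-- The relations between `t_11(u)`, `t_12(u)` and all `t_{kl}(v)`, where `A` stands for `T(u)`,
`B` for `T(v)`, and `D`, `q` for `u - v` and `1`, both multiplied by `u⁻¹ v⁻¹`. -/
structure IsRTTRow (D q : R) (A B : Matrix (Fin 4) (Fin 4) S) : Prop where
  cancel : ∀ (c : ℤ) (z : S), (D + c • q) • z = 0 → z = 0
  rel_zero : ∀ m n, (D * (D + q)) • (A 0 0 * B m n - B m n * A 0 0)
    = (q * (D + q)) • (A m 0 * B 0 n - B m 0 * A 0 n)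
      - (q * D) • ((if m = 3 then
            A 0 0 * B 3 n + A 1 0 * B 2 n - A 2 0 * B 1 n + A 3 0 * B 0 n else 0)
        - (if n = 3 then
            B m 3 * A 0 0 - B m 2 * A 0 1 + B m 1 * A 0 2 + B m 0 * A 0 3 else 0))
  rel_one : ∀ m n, (D * (D + q)) • (A 0 1 * B m n - (sgn m * sgn n) • (B m n * A 0 1))
    = (q * (D + q)) • (sgn m • (A m 1 * B 0 n - B m 1 * A 0 n))
      - (q * D) • ((if m = 3 then
            A 0 1 * B 3 n - A 1 1 * B 2 n + A 2 1 * B 1 n + A 3 1 * B 0 n else 0)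
        - (if n = 2 then
            sgn m • (B m 2 * A 0 1 - B m 3 * A 0 0 - B m 1 * A 0 2 - B m 0 * A 0 3) else 0))

namespace IsRTTRow

variable {D q : R} {A B : Matrix (Fin 4) (Fin 4) S}

theorem cancel_zero (hr : IsRTTRow D q A B) (z : S) (h : D • z = 0) : z = 0 := hr.cancel 0 z (by simpa using h)

theorem cancel_one (hr : IsRTTRow D q A B) (z : S) (h : (D + q) • z = 0) : z = 0 := hr.cancel 1 z (by simpa using h)

theorem cancel_two (hr : IsRTTRow D q A B) (z : S) (h : (D + 2 * q) • z = 0) : z = 0 :=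
  hr.cancel 2 z (by simpa [two_mul, two_smul] using h)

/-- Away from the last row and column the correction terms are absent, and D + q cancels, leaving
the relation of gl type. -/
theorem gl_zero (hr : IsRTTRow D q A B) {m n : Fin 4} (hm : m ≠ 3) (hn : n ≠ 3) :
    D • (A 0 0 * B m n - B m n * A 0 0) = q • (A m 0 * B 0 n - B m 0 * A 0 n) := by
  have h := hr.rel_zero m n
  rw [if_neg hm, if_neg hn] at h
  rw [← sub_eq_zero]
  refine hr.cancel_one _ ?_
  linear_combination (norm := module) h

theorem gl_one (hr : IsRTTRow D q A B) {m n : Fin 4} (hm : m ≠ 3) (hn : n ≠ 2) :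
    D • (A 0 1 * B m n - (sgn m * sgn n) • (B m n * A 0 1))
      = q • (sgn m • (A m 1 * B 0 n - B m 1 * A 0 n)) := by
  have h := hr.rel_one m n
  rw [if_neg hm, if_neg hn] at h
  rw [← sub_eq_zero]
  refine hr.cancel_one _ ?_
  linear_combination (norm := module) h

/-- The right side is q times the commutator itself, so (D - q) annihilates it. -/
theorem comm_zero (hr : IsRTTRow D q A B) : A 0 0 * B 0 0 = B 0 0 * A 0 0 := by
  have h := hr.gl_zero (m := 0) (n := 0) (by decide) (by decide)
  rw [← sub_eq_zero]
  refine hr.cancel (-1) _ ?_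
  linear_combination (norm := module) h

/-- The gl part contracts to multiples of δ_{1l} and δ_{k1} and disappears. In the correction part,
one of the two matrices B, B' contracts in each term, so a single product is left on either side. A
common factor D then cancels. -/
theorem bracket_inverse_zero (hr : IsRTTRow D q A B) {B' : Matrix (Fin 4) (Fin 4) S}
    (h1 : B * B' = 1) (h2 : B' * B = 1) {k l : Fin 4} (hk : k ≠ 0) (hl : l = 2 ∨ l = 3) :
    (D + q) • (A 0 0 * B' k l - B' k l * A 0 0)
      = q • (B' k 3 * A l.rev 0 - theta k • A 0 k.rev * B' 3 l) := by
  have e1 : ∀ p, ∑ n, B p n * B' n l = if p = l then 1 else 0 := fun p => by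
    rw [← Matrix.mul_apply, h1, Matrix.one_apply]
  have e2 : ∀ p, ∑ m, B' k m * B m p = if k = p then 1 else 0 := fun p => by
    rw [← Matrix.mul_apply, h2, Matrix.one_apply]
  let d : Fin 4 → S := fun m => if m = 3 then 1 else 0
  have e3 : ∀ x : S, ∑ m, B' k m * (d m * x) = B' k 3 * x := fun x => by simp [d]
  have e4 : ∀ x : S, ∑ n, (x * d n) * B' n l = x * B' 3 l := fun x => by simp [d]
  have h := bracket_inverse h1 h2 (s := fun _ => 1) (fun _ => rfl) (D * (D + q)) (A 0 0)
    (fun m n => (q * (D + q)) • (A m 0 * B 0 n - B m 0 * A 0 n)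
      - (q * D) • ((d m * A 0 0) * B 3 n + (d m * A 1 0) * B 2 n - (d m * A 2 0) * B 1 n
          + (d m * A 3 0) * B 0 n
        - (B m 3 * (A 0 0 * d n) - B m 2 * (A 0 1 * d n) + B m 1 * (A 0 2 * d n)
          + B m 0 * (A 0 3 * d n))))
    (fun m n => by
      rw [mul_one, one_smul, hr.rel_zero]
      simp only [d]
      split_ifs <;> simp) k l
  simp only [conjSum_add, conjSum_sub, conjSum_smul, conjSum_mul, mul_one, one_smul, e1, e2, e3,
    e4] at h
  have hl0 : (0 : Fin 4) ≠ l := by rcases hl with rfl | rfl <;> decide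
  rw [← sub_eq_zero]
  refine hr.cancel_zero _ ?_
  rw [if_neg hl0, if_neg hk] at h
  have hk' : k = 1 ∨ k = 2 ∨ k = 3 :=
    (by decide : ∀ k : Fin 4, k ≠ 0 → k = 1 ∨ k = 2 ∨ k = 3) k hk
  rcases hl with rfl | rfl <;> rcases hk' with rfl | rfl | rfl <;>
    simp [theta, Fin.rev] at h ⊢ <;>
    linear_combination (norm := module) h

/-- Now the gl part contracts to δ_{1l} and δ_{k2}, so for k = 2 a row of T(u)T(v)⁻¹ survives. -/
theorem bracket_inverse_one (hr : IsRTTRow D q A B) {B' : Matrix (Fin 4) (Fin 4) S}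
    (h1 : B * B' = 1) (h2 : B' * B = 1) {k l : Fin 4} (hk : k ≠ 0) (hl : l = 2 ∨ l = 3) :
    (D * (D + q)) • (A 0 1 * B' k l - (sgn k * sgn l) • (B' k l * A 0 1))
      = -(q * (D + q)) • (if k = 1 then ∑ n, A 0 n * B' n l else 0)
        + (q * D) • ((sgn k * sgn l) • (B' k 3 * A l.rev 1)
          + sgn k • (theta k • A 0 k.rev * B' 2 l)) := by
  have e1 : ∀ p, ∑ n, B p n * B' n l = if p = l then 1 else 0 := fun p => by
    rw [← Matrix.mul_apply, h1, Matrix.one_apply]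
  have e2 : ∀ p, ∑ m, (sgn k * sgn m) • (B' k m * (sgn m • B m p))
      = sgn k • if k = p then 1 else 0 := fun p => by
    rw [← Matrix.one_apply, ← h2, Matrix.mul_apply, Finset.smul_sum]
    refine Finset.sum_congr rfl fun m _ => ?_
    rw [mul_smul_comm, smul_smul, mul_assoc, sgn_mul_self, mul_one]
  let d : Fin 4 → Fin 4 → S := fun i m => if m = i then 1 else 0
  have e3 : ∀ x : S, ∑ m, (sgn k * sgn m) • (B' k m * (d 3 m * x)) = sgn k • (B' k 3 * x) :=
    fun x => by
      rw [Finset.sum_eq_single 3]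
      · simp [d, sgn]
      · intro m _ hm
        simp [d, hm]
      · simp
  have e4 : ∀ x : S, ∑ n, (x * d 2 n) * B' n l = x * B' 2 l := fun x => by simp [d]
  have h := bracket_inverse h1 h2 sgn_mul_self (D * (D + q)) (A 0 1)
    (fun m n => (q * (D + q)) • ((sgn m • A m 1) * B 0 n - (sgn m • B m 1) * A 0 n)
      - (q * D) • ((d 3 m * A 0 1) * B 3 n - (d 3 m * A 1 1) * B 2 n + (d 3 m * A 2 1) * B 1 n
          + (d 3 m * A 3 1) * B 0 n
        - ((sgn m • B m 2) * (A 0 1 * d 2 n) - (sgn m • B m 3) * (A 0 0 * d 2 n)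
          - (sgn m • B m 1) * (A 0 2 * d 2 n) - (sgn m • B m 0) * (A 0 3 * d 2 n))))
    (fun m n => by
      rw [hr.rel_one]
      simp only [d]
      split_ifs <;> simp only [one_mul, mul_one, zero_mul, mul_zero, smul_mul_assoc] <;>
        module) k l
  simp only [conjSum_add, conjSum_sub, conjSum_smul, conjSum_mul, e1, e2, e3, e4] at h
  have hl0 : (0 : Fin 4) ≠ l := by rcases hl with rfl | rfl <;> decide
  rw [if_neg hl0] at h
  have hk' : k = 1 ∨ k = 2 ∨ k = 3 :=
    (by decide : ∀ k : Fin 4, k ≠ 0 → k = 1 ∨ k = 2 ∨ k = 3) k hk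
  rcases hl with rfl | rfl <;> rcases hk' with rfl | rfl | rfl <;>
    simp [theta, sgn, Fin.rev] at h ⊢ <;>
    linear_combination (norm := module) h

end IsRTTRow

end Row

/-! ### Gauss decompositions and their inverses. -/

section Gauss

variable {P : Type*} [Ring P]

/-- A Gauss decomposition `M = F H E`, where `H'` is the inverse of `H`. -/
structure IsGauss (M F E : Matrix (Fin 4) (Fin 4) P) (H H' : Fin 4 → P) : Prop where
  eq : M = F * Matrix.diagonal H * E
  F_diag : ∀ i, F i i = 1
  F_lt : ∀ i j, i < j → F i j = 0
  E_diag : ∀ i, E i i = 1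
  E_lt : ∀ i j, j < i → E i j = 0
  mul : ∀ i, H i * H' i = 1
  mul' : ∀ i, H' i * H i = 1

theorem exists_inverse_upper {E : Matrix (Fin 4) (Fin 4) P} (h1 : ∀ i, E i i = 1)
    (h0 : ∀ i j, j < i → E i j = 0) :
    ∃ V : Matrix (Fin 4) (Fin 4) P, E * V = 1 ∧ V * E = 1 ∧ (∀ i, V i i = 1) ∧
      (∀ i j, j < i → V i j = 0) ∧ V 1 2 = -E 1 2 ∧ V 0 2 = E 0 1 * E 1 2 - E 0 2 := by
  have z1 := h0 1 0 (by decide)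
  have z2 := h0 2 0 (by decide)
  have z3 := h0 2 1 (by decide)
  have z4 := h0 3 0 (by decide)
  have z5 := h0 3 1 (by decide)
  have z6 := h0 3 2 (by decide)
  refine ⟨!![1, -E 0 1, E 0 1 * E 1 2 - E 0 2,
      E 0 1 * E 1 3 + E 0 2 * E 2 3 - E 0 1 * E 1 2 * E 2 3 - E 0 3;
    0, 1, -E 1 2, E 1 2 * E 2 3 - E 1 3; 0, 0, 1, -E 2 3; 0, 0, 0, 1], ?_, ?_, ?_, ?_, rfl, rfl⟩
  · ext i j
    fin_cases i <;> fin_cases j <;>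
      simp [Matrix.mul_apply, Fin.sum_univ_four, h1, z1, z2, z3, z4, z5, z6] <;>
      try noncomm_ring
  · ext i j
    fin_cases i <;> fin_cases j <;>
      simp [Matrix.mul_apply, Fin.sum_univ_four, h1, z1, z2, z3, z4, z5, z6] <;>
      try noncomm_ring
  · intro i; fin_cases i <;> rfl
  · intro i j hij; fin_cases i <;> fin_cases j <;> first | rfl | simp [Fin.lt_def] at hij

theorem exists_inverse_lower {F : Matrix (Fin 4) (Fin 4) P} (h1 : ∀ i, F i i = 1)
    (h0 : ∀ i j, i < j → F i j = 0) :
    ∃ V : Matrix (Fin 4) (Fin 4) P, F * V = 1 ∧ V * F = 1 ∧ (∀ i, V i i = 1) ∧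
      ∀ i j, i < j → V i j = 0 := by
  have z1 := h0 0 1 (by decide)
  have z2 := h0 0 2 (by decide)
  have z3 := h0 1 2 (by decide)
  have z4 := h0 0 3 (by decide)
  have z5 := h0 1 3 (by decide)
  have z6 := h0 2 3 (by decide)
  refine ⟨!![1, 0, 0, 0; -F 1 0, 1, 0, 0; F 2 1 * F 1 0 - F 2 0, -F 2 1, 1, 0;
    F 3 1 * F 1 0 + F 3 2 * F 2 0 - F 3 2 * F 2 1 * F 1 0 - F 3 0, F 3 2 * F 2 1 - F 3 1,
      -F 3 2, 1], ?_, ?_, ?_, ?_⟩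
  · ext i j
    fin_cases i <;> fin_cases j <;>
      simp [Matrix.mul_apply, Fin.sum_univ_four, h1, z1, z2, z3, z4, z5, z6] <;>
      try noncomm_ring
  · ext i j
    fin_cases i <;> fin_cases j <;>
      simp [Matrix.mul_apply, Fin.sum_univ_four, h1, z1, z2, z3, z4, z5, z6] <;>
      try noncomm_ring
  · intro i; fin_cases i <;> rfl
  · intro i j hij; fin_cases i <;> fin_cases j <;> first | rfl | simp [Fin.lt_def] at hij

namespace IsGauss

variable {M F E : Matrix (Fin 4) (Fin 4) P} {H H' : Fin 4 → P}

theorem apply (hG : IsGauss M F E H H') (i j : Fin 4) :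
    M i j = F i 0 * H 0 * E 0 j + F i 1 * H 1 * E 1 j + F i 2 * H 2 * E 2 j
      + F i 3 * H 3 * E 3 j := by
  rw [hG.eq, Matrix.mul_apply, Fin.sum_univ_four]
  simp only [Matrix.mul_diagonal]

theorem apply_zero_left (hG : IsGauss M F E H H') (j : Fin 4) : M 0 j = H 0 * E 0 j := by
  rw [hG.apply, hG.F_diag, hG.F_lt 0 1 (by decide), hG.F_lt 0 2 (by decide),
    hG.F_lt 0 3 (by decide)]
  simp

theorem apply_zero_right (hG : IsGauss M F E H H') (i : Fin 4) : M i 0 = F i 0 * H 0 := by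
  rw [hG.apply, hG.E_diag, hG.E_lt 1 0 (by decide), hG.E_lt 2 0 (by decide),
    hG.E_lt 3 0 (by decide)]
  simp

theorem apply_zero (hG : IsGauss M F E H H') : M 0 0 = H 0 := by
  rw [hG.apply_zero_left, hG.E_diag, mul_one]

theorem schur (hG : IsGauss M F E H H') (i j : Fin 4) :
    M i j - M i 0 * H' 0 * M 0 j = F i 1 * H 1 * E 1 j + F i 2 * H 2 * E 2 j
      + F i 3 * H 3 * E 3 j := by
  rw [hG.apply_zero_left, hG.apply_zero_right, hG.apply i j,
    show F i 0 * H 0 * H' 0 * (H 0 * E 0 j) = F i 0 * (H 0 * H' 0) * (H 0 * E 0 j) by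
      simp only [mul_assoc], hG.mul, mul_one, ← mul_assoc]
  abel

theorem schur_one_left (hG : IsGauss M F E H H') (j : Fin 4) :
    M 1 j - M 1 0 * H' 0 * M 0 j = H 1 * E 1 j := by
  rw [hG.schur, hG.F_diag, hG.F_lt 1 2 (by decide), hG.F_lt 1 3 (by decide)]
  simp

theorem schur_one_right (hG : IsGauss M F E H H') (i : Fin 4) :
    M i 1 - M i 0 * H' 0 * M 0 1 = F i 1 * H 1 := by
  rw [hG.schur, hG.E_diag, hG.E_lt 2 1 (by decide), hG.E_lt 3 1 (by decide)]
  simp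

theorem schur_two (hG : IsGauss M F E H H') :
    M 2 2 - M 2 0 * H' 0 * M 0 2 = F 2 1 * H 1 * E 1 2 + H 2 := by
  rw [hG.schur, hG.F_diag, hG.E_diag, hG.F_lt 2 3 (by decide)]
  simp

/-- The inverse of `M`, with the entries of its third column after elimination of the fourth
one. -/
theorem exists_inverse (hG : IsGauss M F E H H') :
    ∃ N : Matrix (Fin 4) (Fin 4) P, M * N = 1 ∧ N * M = 1 ∧ N 3 3 = H' 3 ∧
      N 3 2 - N 3 3 * H 3 * N 3 2 = 0 ∧
      N 2 2 - N 2 3 * H 3 * N 3 2 = H' 2 ∧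
      N 1 2 - N 1 3 * H 3 * N 3 2 = -(E 1 2 * H' 2) ∧
      N 0 2 - N 0 3 * H 3 * N 3 2 = (E 0 1 * E 1 2 - E 0 2) * H' 2 := by
  obtain ⟨V, hV1, hV2, hVd, hV0, hV12, hV02⟩ := exists_inverse_upper hG.E_diag hG.E_lt
  obtain ⟨W, hW1, hW2, hWd, hW0⟩ := exists_inverse_lower hG.F_diag hG.F_lt
  have hH : Matrix.diagonal H * Matrix.diagonal H' = 1 := by
    rw [Matrix.diagonal_mul_diagonal, ← Matrix.diagonal_one]; simp only [hG.mul]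
  have hH' : Matrix.diagonal H' * Matrix.diagonal H = 1 := by
    rw [Matrix.diagonal_mul_diagonal, ← Matrix.diagonal_one]; simp only [hG.mul']
  have entry : ∀ i j, (V * Matrix.diagonal H' * W) i j = V i 0 * H' 0 * W 0 j
      + V i 1 * H' 1 * W 1 j + V i 2 * H' 2 * W 2 j + V i 3 * H' 3 * W 3 j := fun i j => by
    rw [Matrix.mul_apply, Fin.sum_univ_four]
    simp only [Matrix.mul_diagonal]
  have entry3 : ∀ i, (V * Matrix.diagonal H' * W) i 3 = V i 3 * H' 3 := fun i => by
    rw [entry, hWd, hW0 0 3 (by decide), hW0 1 3 (by decide), hW0 2 3 (by decide)]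
    simp
  have entry32 : (V * Matrix.diagonal H' * W) 3 2 = H' 3 * W 3 2 := by
    rw [entry, hVd, hV0 3 0 (by decide), hV0 3 1 (by decide), hV0 3 2 (by decide)]
    simp
  -- Since N = V H⁻¹ W with V upper and W lower unitriangular, elimination with pivot N_44 = h_4⁻¹
  -- removes the fourth summand, and only V_i3 h_3⁻¹ remains in the third column.
  have col : ∀ i, (V * Matrix.diagonal H' * W) i 2
      - (V * Matrix.diagonal H' * W) i 3 * H 3 * (V * Matrix.diagonal H' * W) 3 2
      = V i 2 * H' 2 := fun i => by
    rw [entry3, entry32, entry i 2, hWd, hW0 0 2 (by decide), hW0 1 2 (by decide),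
      show V i 3 * H' 3 * H 3 * (H' 3 * W 3 2) = V i 3 * (H' 3 * H 3) * (H' 3 * W 3 2) by
        simp only [mul_assoc], hG.mul', mul_one, ← mul_assoc]
    simp
  refine ⟨V * Matrix.diagonal H' * W, ?_, ?_, ?_, ?_, ?_, ?_, ?_⟩
  · rw [hG.eq, show F * Matrix.diagonal H * E * (V * Matrix.diagonal H' * W)
      = F * (Matrix.diagonal H * (E * V) * Matrix.diagonal H') * W by simp only [Matrix.mul_assoc],
      hV1, mul_one, hH, mul_one, hW1]
  · rw [hG.eq, show V * Matrix.diagonal H' * W * (F * Matrix.diagonal H * E)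
      = V * (Matrix.diagonal H' * (W * F) * Matrix.diagonal H) * E by simp only [Matrix.mul_assoc],
      hW2, mul_one, hH', mul_one, hV2]
  · rw [entry3, hVd, one_mul]
  · rw [col, hV0 3 2 (by decide), zero_mul]
  · rw [col, hVd, one_mul]
  · rw [col, hV12, neg_mul]
  · rw [col, hV02]

theorem map {S : Type*} [Ring S] (hG : IsGauss M F E H H') (φ : P →+* S) :
    IsGauss (M.map φ) (F.map φ) (E.map φ) (φ ∘ H) (φ ∘ H') where
  eq := by
    rw [hG.eq, Matrix.map_mul, Matrix.map_mul, Matrix.diagonal_map (map_zero φ)]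
    rfl
  F_diag i := by rw [Matrix.map_apply, hG.F_diag, map_one]
  F_lt i j hij := by rw [Matrix.map_apply, hG.F_lt i j hij, map_zero]
  E_diag i := by rw [Matrix.map_apply, hG.E_diag, map_one]
  E_lt i j hij := by rw [Matrix.map_apply, hG.E_lt i j hij, map_zero]
  mul i := by simp only [Function.comp_apply, ← map_mul, hG.mul, map_one]
  mul' i := by simp only [Function.comp_apply, ← map_mul, hG.mul', map_one]

end IsGauss

end Gauss

/-! ### Brackets obtained by eliminating the first row and column of T(v). -/

section Brackets

variable {R S : Type*} [CommRing R] [Ring S] [Algebra R S] {D q : R}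
  {A F₁ E₁ B F E : Matrix (Fin 4) (Fin 4) S} {H₁ H₁' H H' : Fin 4 → S}

theorem commute_inverse {a h h' : S} (h1 : Commute a h) (hh : h * h' = 1) (hh' : h' * h = 1) :
    Commute a h' :=
  Commute.units_inv_right (u := ⟨h, h', hh, hh'⟩) h1

namespace IsRTTRow

theorem commute_schur (hr : IsRTTRow D q A B) (hA : IsGauss A F₁ E₁ H₁ H₁')
    (hB : IsGauss B F E H H') {m n : Fin 4} (hm : m ≠ 3) (hn : n ≠ 3) :
    Commute (H₁ 0) (B m n - B m 0 * H' 0 * B 0 n) := by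
  rw [← hA.apply_zero]
  have hc : Commute (A 0 0) (H' 0) := commute_inverse (by
    rw [← hB.apply_zero]; exact hr.comm_zero) (hB.mul 0) (hB.mul' 0)
  rw [commute_iff_eq, ← sub_eq_zero]
  exact hr.cancel_zero _ (OspTwoTwo.commute_schur D q (hr.gl_zero hm (by decide))
    (hr.gl_zero (by decide) hn) (hr.gl_zero hm hn) hc (by rw [hB.apply_zero]; exact hB.mul 0)
    (by rw [hB.apply_zero]; exact hB.mul' 0))

theorem commute_H_one (hr : IsRTTRow D q A B) (hA : IsGauss A F₁ E₁ H₁ H₁')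
    (hB : IsGauss B F E H H') : Commute (H₁ 0) (H 1) := by
  have := hr.commute_schur hA hB (m := 1) (n := 1) (by decide) (by decide)
  rwa [hB.schur_one_left, hB.E_diag, mul_one] at this

theorem commute_E (hr : IsRTTRow D q A B) (hA : IsGauss A F₁ E₁ H₁ H₁')
    (hB : IsGauss B F E H H') : Commute (H₁ 0) (E 1 2) := by
  have h1 := hr.commute_H_one hA hB
  have h2 := hr.commute_schur hA hB (m := 1) (n := 2) (by decide) (by decide)
  rw [hB.schur_one_left] at h2
  have := (commute_inverse h1 (hB.mul 1) (hB.mul' 1)).mul_right h2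
  rwa [← mul_assoc, hB.mul', one_mul] at this

theorem commute_F (hr : IsRTTRow D q A B) (hA : IsGauss A F₁ E₁ H₁ H₁')
    (hB : IsGauss B F E H H') : Commute (H₁ 0) (F 2 1) := by
  have h1 := hr.commute_H_one hA hB
  have h2 := hr.commute_schur hA hB (m := 2) (n := 1) (by decide) (by decide)
  rw [hB.schur_one_right] at h2
  have := h2.mul_right (commute_inverse h1 (hB.mul 1) (hB.mul' 1))
  rwa [mul_assoc, hB.mul, mul_one] at this

/-- The Schur complement at (3,3) is f_32 h_2 e_23 + h_3, and h_1(u) commutes with it and with each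
factor of the first summand. -/
theorem commute_H_two (hr : IsRTTRow D q A B) (hA : IsGauss A F₁ E₁ H₁ H₁')
    (hB : IsGauss B F E H H') : Commute (H₁ 0) (H 2) := by
  have h2 := hr.commute_schur hA hB (m := 2) (n := 2) (by decide) (by decide)
  rw [hB.schur_two] at h2
  have := h2.sub_right (((hr.commute_F hA hB).mul_right (hr.commute_H_one hA hB)).mul_right
    (hr.commute_E hA hB))
  rwa [add_sub_cancel_left] at this

/-- `bracket_schur_left` gives the bracket of t_12(u) = h_1(u) e_12(u). The factor h_1(u) commutes
with the Schur complement and can be cancelled on the left. -/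
theorem bracket_E_schur (hr : IsRTTRow D q A B) (hA : IsGauss A F₁ E₁ H₁ H₁')
    (hB : IsGauss B F E H H') {m : Fin 4} (hm : m = 1 ∨ m = 2) :
    D • (E₁ 0 1 * (F m 1 * H 1) - F m 1 * H 1 * E₁ 0 1)
      = q • (F m 1 * H 1 * (E₁ 0 1 - E 0 1)) := by
  have hm3 : m ≠ 3 := by rcases hm with rfl | rfl <;> decide
  have hs : sgn m = -1 := by rcases hm with rfl | rfl <;> rfl
  have h1 := hr.gl_one (n := 1) hm3 (by decide)
  have h2 := hr.gl_one (n := 0) hm3 (by decide)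
  have h3 := hr.gl_one (m := 0) (n := 1) (by decide) (by decide)
  have h4 := hr.gl_one (m := 0) (n := 0) (by decide) (by decide)
  simp only [hs, show sgn 0 = 1 from rfl, show sgn 1 = -1 from rfl, mul_one, mul_neg, neg_neg,
    one_smul, neg_smul, sub_neg_eq_add, smul_neg] at h1 h2 h3 h4
  have key := bracket_schur_left (h' := H' 0) D q (h1.trans (neg_smul q _).symm)
    (h2.trans (neg_smul q _).symm) h3 h4 (by rw [hB.apply_zero]; exact hB.mul 0)
    (by rw [hB.apply_zero]; exact hB.mul' 0)
  have hc := hr.commute_schur hA hB (m := m) (n := 1) hm3 (by decide)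
  rw [hB.schur_one_right] at hc key
  rw [hB.apply_zero_left 1, ← mul_assoc (H' 0), hB.mul', one_mul, hA.apply_zero_left 1,
    hA.apply_zero] at key
  have key' : H₁ 0 * (D • (E₁ 0 1 * (F m 1 * H 1) - F m 1 * H 1 * E₁ 0 1)
      - q • (F m 1 * H 1 * (E₁ 0 1 - E 0 1))) = 0 := by
    linear_combination (norm := (simp only [mul_sub,
      mul_smul_comm, mul_assoc]; module)) key - D • (hc.eq * E₁ 0 1)
        - q • (hc.eq * (E₁ 0 1 - E 0 1))
  have := congrArg (H₁' 0 * ·) key'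
  rw [← sub_eq_zero]
  simpa only [← mul_assoc, hA.mul', one_mul, mul_zero] using this

/-- The brackets of e_12(u) with h_2 and f_32 h_2 have the same form, so the second minus f_32 times
the first has zero right side. It equals [e_12(u), f_32] h_2, and h_2 is invertible. -/
theorem commute_E_F (hr : IsRTTRow D q A B) (hA : IsGauss A F₁ E₁ H₁ H₁')
    (hB : IsGauss B F E H H') : E₁ 0 1 * F 2 1 - F 2 1 * E₁ 0 1 = 0 := by
  have h1 := hr.bracket_E_schur hA hB (m := 1) (Or.inl rfl)
  have h2 := hr.bracket_E_schur hA hB (m := 2) (Or.inr rfl)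
  rw [hB.F_diag, one_mul] at h1
  have key : D • ((E₁ 0 1 * F 2 1 - F 2 1 * E₁ 0 1) * H 1) = 0 := by
    linear_combination (norm := (simp only [mul_sub, sub_mul,
      mul_smul_comm, mul_assoc]; module)) h2 - F 2 1 * h1
  have := congrArg (· * H' 1) (hr.cancel_zero _ key)
  simpa only [mul_assoc, hB.mul, mul_one, zero_mul] using this

end IsRTTRow

end Brackets

/-! ### Brackets obtained by eliminating the last row and column of T(v)⁻¹. -/

section Brackets

variable {R S : Type*} [CommRing R] [Ring S] [Algebra R S] {D q : R}
  {A F₁ E₁ B F E N : Matrix (Fin 4) (Fin 4) S} {H₁ H₁' H H' : Fin 4 → S}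

namespace IsRTTRow

/-- For k = l = 4 the right side is -q times the bracket, so (D + 2q) annihilates the bracket of
t_11(u) with h_4⁻¹. -/
theorem commute_H_three (hr : IsRTTRow D q A B)
    (hB : IsGauss B F E H H') (h1 : B * N = 1) (h2 : N * B = 1) (h33 : N 3 3 = H' 3) :
    Commute (A 0 0) (H 3) := by
  have h := hr.bracket_inverse_zero h1 h2 (k := 3) (l := 3) (by decide) (Or.inr rfl)
  simp only [show theta 3 = 1 from rfl, one_smul, show Fin.rev (3 : Fin 4) = 0 from rfl] at h
  have hc : A 0 0 * N 3 3 - N 3 3 * A 0 0 = 0 := by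
    refine hr.cancel_two _ ?_
    linear_combination (norm := module) h
  rw [h33, sub_eq_zero] at hc
  exact commute_inverse hc (hB.mul' 3) (hB.mul 3)

/-- The bracket of t_12(u) with the Schur complement of N comes from `bracket_schur_right`;
`bracket_of_bracket_mul` then divides by t_11(u). `Q` is the surviving gl term after this division.
-/
theorem bracket_inverse_schur (hr : IsRTTRow D q A B) (hA : IsGauss A F₁ E₁ H₁ H₁')
    (hB : IsGauss B F E H H') (h1 : B * N = 1) (h2 : N * B = 1) (h33 : N 3 3 = H' 3)
    {k : Fin 4} (hk : k = 1 ∨ k = 2) {Q : S}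
    (hQ : ((if k = 1 then ∑ n, A 0 n * N n 2 else 0)
      - (if k = 1 then ∑ n, A 0 n * N n 3 else 0) * H 3 * N 3 2) = A 0 0 * Q) :
    (D * (D + 2 * q)) • (E₁ 0 1 * (N k 2 - N k 3 * H 3 * N 3 2)
        - (N k 2 - N k 3 * H 3 * N 3 2) * E₁ 0 1)
      = -(q * (D + 2 * q)) • Q - (q * D) • ((theta k • E₁ 0 k.rev - N k 3 * H 3)
          * (N 2 2 - N 2 3 * H 3 * N 3 2)) := by
  have hk0 : k ≠ 0 := by rcases hk with rfl | rfl <;> decide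
  have hs : sgn k = -1 := by rcases hk with rfl | rfl <;> rfl
  have hw : N 3 3 * H 3 = 1 := by rw [h33, hB.mul']
  have hw' : H 3 * N 3 3 = 1 := by rw [h33, hB.mul]
  have hc := hr.commute_H_three hB h1 h2 h33
  have r0 : Fin.rev (2 : Fin 4) = 1 := rfl
  have r1 : Fin.rev (3 : Fin 4) = 0 := rfl
  have c1 := hr.bracket_inverse_zero h1 h2 hk0 (l := 2) (Or.inl rfl)
  have c2 := hr.bracket_inverse_zero h1 h2 hk0 (l := 3) (Or.inr rfl)
  have c3 := hr.bracket_inverse_zero h1 h2 (k := 3) (l := 2) (by decide) (Or.inl rfl)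
  have n1 := hr.bracket_inverse_one h1 h2 hk0 (l := 2) (Or.inl rfl)
  have n2 := hr.bracket_inverse_one h1 h2 hk0 (l := 3) (Or.inr rfl)
  have n3 := hr.bracket_inverse_one h1 h2 (k := 3) (l := 2) (by decide) (Or.inl rfl)
  have n4 := hr.bracket_inverse_one h1 h2 (k := 3) (l := 3) (by decide) (Or.inr rfl)
  simp only [r0, r1, hs, show theta 3 = 1 from rfl, show sgn 2 = -1 from rfl,
    show sgn 3 = 1 from rfl, if_neg (show (3 : Fin 4) ≠ 1 by decide), one_smul, mul_one,
    neg_smul, neg_neg, sub_neg_eq_add, mul_neg, smul_zero, zero_add]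
    at c1 c2 c3 n1 n2 n3 n4
  have has : A 0 0 * (N k 2 - N k 3 * H 3 * N 3 2) = (N k 2 - N k 3 * H 3 * N 3 2) * A 0 0 := by
    rw [← sub_eq_zero]
    -- The relations for the inverse have the shape required by `commute_schur` with D + q and -q in
    -- place of D and q.
    refine hr.cancel_one _ (OspTwoTwo.commute_schur (D + q) (-q) (h := N 3 3)
      (am := theta k • A 0 k.rev) (an := A 1 0) ?_ ?_ ?_ hc hw hw')
    · rw [c2]; module
    · rw [c3]; module
    · rw [c1]; module
  have hv : (D + q) • (A 0 0 * (N k 3 * H 3) - N k 3 * H 3 * A 0 0)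
      = q • (N k 3 * H 3 * A 0 0 - theta k • A 0 k.rev) := by
    linear_combination (norm := (simp only [sub_mul, smul_mul_assoc, mul_assoc, mul_one]; module))
      c2 * H 3 - q • (theta k • A 0 k.rev * hw)
        + (D + q) • (N k 3 * hc.eq) + q • (N k 3 * hc.eq)
  have hz : A 0 0 * (theta k • E₁ 0 k.rev) = theta k • A 0 k.rev := by
    rw [mul_smul_comm, hA.apply_zero, ← hA.apply_zero_left]
  have hx : A 0 0 * E₁ 0 1 = A 0 1 := by rw [hA.apply_zero, ← hA.apply_zero_left]
  have key := bracket_schur_right (D * (D + q)) (q * (D + q)) (q * D) (a := A 0 0) (b := A 0 1)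
    (c := A 1 1) (t := N k 2) (p := N k 3) (p₄ := N 3 3) (p₄₃ := N 3 2) (w := H 3)
    (z := theta k • A 0 k.rev) (g₂ := N 2 2) (g₃ := N 2 3)
    (P₂ := if k = 1 then ∑ n, A 0 n * N n 2 else 0)
    (P₃ := if k = 1 then ∑ n, A 0 n * N n 3 else 0)
    (by rw [n1]; module) (by rw [n2]; module) (by rw [n3]; module) (by rw [n4]) hw hw'
  rw [hQ] at key
  refine bracket_of_bracket_mul D q hr.cancel_one (a := A 0 0) (a' := H₁' 0)
    (by rw [hA.apply_zero, hA.mul']) has ?_ ?_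
  · rw [hx, hz, key]
  · rw [hz, hv]

/-- For k = 3 there is no gl term, and θ_3 = -1 gives the sign of e_12(u). Here N_34 h_4 is
-e_34(v), but only its independence of u will matter. -/
theorem bracket_E_H_inverse (hr : IsRTTRow D q A B) (hA : IsGauss A F₁ E₁ H₁ H₁')
    (hB : IsGauss B F E H H') (h1 : B * N = 1) (h2 : N * B = 1) (h33 : N 3 3 = H' 3)
    (h22 : N 2 2 - N 2 3 * H 3 * N 3 2 = H' 2) :
    (D + 2 * q) • (E₁ 0 1 * H' 2 - H' 2 * E₁ 0 1) = q • ((E₁ 0 1 + N 2 3 * H 3) * H' 2) := by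
  have h := hr.bracket_inverse_schur hA hB h1 h2 h33 (k := 2) (Or.inr rfl) (Q := 0) (by simp)
  rw [h22] at h
  simp only [show theta 2 = -1 from rfl, show Fin.rev (2 : Fin 4) = 1 from rfl] at h
  rw [← sub_eq_zero]
  refine hr.cancel_zero _ ?_
  linear_combination (norm := (simp only [sub_mul, add_mul, smul_mul_assoc]; module)) h

theorem bracket_E_H (hr : IsRTTRow D q A B) (hA : IsGauss A F₁ E₁ H₁ H₁')
    (hB : IsGauss B F E H H') (h1 : B * N = 1) (h2 : N * B = 1) (h33 : N 3 3 = H' 3)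
    (h22 : N 2 2 - N 2 3 * H 3 * N 3 2 = H' 2) :
    (D + 2 * q) • (H 2 * E₁ 0 1 - E₁ 0 1 * H 2) = q • (H 2 * (E₁ 0 1 + N 2 3 * H 3)) := by
  have h := hr.bracket_E_H_inverse hA hB h1 h2 h33 h22
  linear_combination (norm := (simp only [mul_sub, sub_mul, mul_add, add_mul, smul_mul_assoc,
    mul_smul_comm, mul_assoc, mul_one, one_mul]; module)) H 2 * h * H 2
      - (D + 2 * q) • ((H 2 * E₁ 0 1) * hB.mul' 2) + (D + 2 * q) • (hB.mul 2 * (E₁ 0 1 * H 2))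
      + q • ((H 2 * (E₁ 0 1 + N 2 3 * H 3)) * hB.mul' 2)

/-- The expected relation up to a remainder that involves v only, shown to be zero by specialization
in `bracket_E_E`. -/
theorem bracket_E_E_add (hr : IsRTTRow D q A B) (hA : IsGauss A F₁ E₁ H₁ H₁')
    (hB : IsGauss B F E H H') (h1 : B * N = 1) (h2 : N * B = 1) (h33 : N 3 3 = H' 3)
    (h32 : N 3 2 - N 3 3 * H 3 * N 3 2 = 0)
    (h22 : N 2 2 - N 2 3 * H 3 * N 3 2 = H' 2)
    (h12 : N 1 2 - N 1 3 * H 3 * N 3 2 = -(E 1 2 * H' 2))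
    (h02 : N 0 2 - N 0 3 * H 3 * N 3 2 = (E 0 1 * E 1 2 - E 0 2) * H' 2) :
    (D + q) • (D • (E₁ 0 1 * E 1 2 - E 1 2 * E₁ 0 1)
        - (2 * q) • (E₁ 0 2 - E 0 2 - E₁ 0 1 * E 1 2 + E 0 1 * E 1 2))
      = (q * D) • (E 0 2 - E 0 1 * E 1 2 - N 1 3 * H 3 - E 1 2 * (N 2 3 * H 3)) := by
  -- The gl term is t_11(u) times the row (e_1n(u)) applied to the eliminated third column of N,
  -- whose fourth entry is zero.
  have hQ : (∑ n, A 0 n * N n 2) - (∑ n, A 0 n * N n 3) * H 3 * N 3 2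
      = A 0 0 * ((E 0 1 * E 1 2 - E 0 2) * H' 2 - E₁ 0 1 * (E 1 2 * H' 2) + E₁ 0 2 * H' 2) := by
    have e : ∀ n, A 0 n = A 0 0 * E₁ 0 n := fun n => by
      rw [hA.apply_zero, ← hA.apply_zero_left]
    rw [← h02, ← neg_eq_iff_eq_neg.mpr h12, ← h22, Finset.sum_mul, Finset.sum_mul,
      ← Finset.sum_sub_distrib]
    have : ∀ n, A 0 n * N n 2 - A 0 n * N n 3 * H 3 * N 3 2
        = A 0 n * (N n 2 - N n 3 * H 3 * N 3 2) := fun n => by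
      simp only [mul_sub, mul_assoc]
    simp only [this, Fin.sum_univ_four, h32, e 1, e 2]
    noncomm_ring
  have hb := hr.bracket_E_H_inverse hA hB h1 h2 h33 h22
  have h := hr.bracket_inverse_schur hA hB h1 h2 h33 (k := 1) (Or.inl rfl) hQ
  rw [h22, h12] at h
  simp only [show theta 1 = 1 from rfl, one_smul, show Fin.rev (1 : Fin 4) = 2 from rfl] at h
  have key : ((D + q) • (D • (E₁ 0 1 * E 1 2 - E 1 2 * E₁ 0 1)
        - (2 * q) • (E₁ 0 2 - E 0 2 - E₁ 0 1 * E 1 2 + E 0 1 * E 1 2))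
      - (q * D) • (E 0 2 - E 0 1 * E 1 2 - N 1 3 * H 3 - E 1 2 * (N 2 3 * H 3))) * H' 2 = 0 := by
    -- `h` concerns -e_23 h_3⁻¹; subtracting e_23 times the bracket with h_3⁻¹ isolates [e_12(u),
    -- e_23] h_3⁻¹.
    linear_combination (norm := (simp only [mul_sub, sub_mul, mul_add, add_mul, smul_mul_assoc,
      mul_smul_comm, mul_assoc, mul_neg, neg_mul]; module)) -h - D • (E 1 2 * hb)
  have := congrArg (· * H 2) key
  rw [← sub_eq_zero]
  simpa only [mul_assoc, hB.mul', mul_one, zero_mul] using this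

end IsRTTRow

end Brackets

/-! ### Brackets for one Gauss decomposition read at both u and v. -/

section Package

variable {R P S : Type*} [CommRing R] [Ring P] [Ring S] [Algebra R S] {D q : R}
  {T F E : Matrix (Fin 4) (Fin 4) P} {H H' : Fin 4 → P} {φ ψ : P →+* S}

theorem IsRTTRow.bracket_E_F (hr : IsRTTRow D q (T.map φ) (T.map ψ)) (hT : IsGauss T F E H H') :
    φ (E 0 1) * ψ (F 2 1) - ψ (F 2 1) * φ (E 0 1) = 0 :=
  hr.commute_E_F (hT.map φ) (hT.map ψ)

/-- `hspec` abstracts the specialization u = v - 1, where D + q vanishes and D does not: it kills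
the remainder in `bracket_E_E_add`. -/
theorem IsRTTRow.bracket_E_E (hr : IsRTTRow D q (T.map φ) (T.map ψ)) (hT : IsGauss T F E H H')
    (hspec : ∀ (ρ : P) (L : S), (D + q) • L = (q * D) • ψ ρ → ρ = 0) :
    D • (φ (E 0 1) * ψ (E 1 2) - ψ (E 1 2) * φ (E 0 1)) = (2 * q) •
      (φ (E 0 2) - ψ (E 0 2) - φ (E 0 1) * ψ (E 1 2) + ψ (E 0 1) * ψ (E 1 2)) := by
  obtain ⟨N, h1, h2, h33, h32, h22, h12, h02⟩ := hT.exists_inverse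
  have m1 : T.map ψ * N.map ψ = 1 := by
    rw [← Matrix.map_mul, h1, Matrix.map_one _ (map_zero ψ) (map_one ψ)]
  have m2 : N.map ψ * T.map ψ = 1 := by
    rw [← Matrix.map_mul, h2, Matrix.map_one _ (map_zero ψ) (map_one ψ)]
  have key := hr.bracket_E_E_add (hT.map φ) (hT.map ψ) m1 m2 (congrArg ψ h33)
    (by simpa using congrArg ψ h32) (by simpa using congrArg ψ h22)
    (by simpa using congrArg ψ h12) (by simpa using congrArg ψ h02)
  simp only [Matrix.map_apply, Function.comp_apply] at key
  have h0 := hspec (E 0 2 - E 0 1 * E 1 2 - N 1 3 * H 3 - E 1 2 * (N 2 3 * H 3)) _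
    (by rw [key]; simp only [map_sub, map_mul])
  rw [← sub_eq_zero]
  refine hr.cancel_one _ (key.trans ?_)
  simp only [← map_mul, ← map_sub, h0, map_zero, smul_zero]

/-- The series `t` depends on v only, which is enough for specialization at u = v - 2 to determine
it later. -/
theorem IsRTTRow.exists_bracket_H_E (hr : IsRTTRow D q (T.map φ) (T.map ψ))
    (hT : IsGauss T F E H H') : ∃ t : P,
      (D + 2 * q) • (ψ (H 2) * φ (E 0 1) - φ (E 0 1) * ψ (H 2))
        = q • (ψ (H 2) * (φ (E 0 1) - ψ t)) := by
  obtain ⟨N, h1, h2, h33, h32, h22, h12, h02⟩ := hT.exists_inverse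
  have m1 : T.map ψ * N.map ψ = 1 := by
    rw [← Matrix.map_mul, h1, Matrix.map_one _ (map_zero ψ) (map_one ψ)]
  have m2 : N.map ψ * T.map ψ = 1 := by
    rw [← Matrix.map_mul, h2, Matrix.map_one _ (map_zero ψ) (map_one ψ)]
  refine ⟨-(N 2 3 * H 3), ?_⟩
  have key := hr.bracket_E_H (hT.map φ) (hT.map ψ) m1 m2 (congrArg ψ h33)
    (by simpa using congrArg ψ h22)
  simpa only [Matrix.map_apply, Function.comp_apply, map_neg, map_mul, sub_neg_eq_add] using key

end Package

/-! ### The signed transpose over the opposite ring. -/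

section Twist

open MulOpposite

/-- Signs making `t_{ij} ↦ ε_i ε_j t_{ji}` an anti-automorphism. -/
def twistSign : Fin 4 → ℤ := ![1, 1, 1, -1]

theorem twistSign_mul_self (i : Fin 4) : twistSign i * twistSign i = 1 := by revert i; decide

/-- The transpose of `M` over the opposite ring, with signs. -/
def twist {P : Type*} [Ring P] (M : Matrix (Fin 4) (Fin 4) P) : Matrix (Fin 4) (Fin 4) Pᵐᵒᵖ :=
  fun i j => (twistSign i * twistSign j) • op (M j i)

theorem twist_map {P S : Type*} [Ring P] [Ring S] (φ : P →+* S)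
    (M : Matrix (Fin 4) (Fin 4) P) : (twist M).map (RingHom.op φ) = twist (M.map φ) := by
  ext1 i j
  simp only [Matrix.map_apply, twist, map_zsmul]
  rfl

theorem IsGauss.twist {P : Type*} [Ring P] {M F E : Matrix (Fin 4) (Fin 4) P} {H H' : Fin 4 → P}
    (hG : IsGauss M F E H H') :
    IsGauss (twist M) (twist E) (twist F) (op ∘ H) (op ∘ H') where
  eq := by
    ext1 i j
    rw [Matrix.mul_apply]
    simp only [Matrix.mul_diagonal, OspTwoTwo.twist, Function.comp_apply]
    rw [hG.eq, Matrix.mul_apply, Finset.op_sum, Finset.smul_sum]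
    refine Finset.sum_congr rfl fun p _ => ?_
    rw [Matrix.mul_diagonal, smul_mul_assoc, smul_mul_assoc, mul_smul_comm, smul_smul,
      show twistSign i * twistSign p * (twistSign p * twistSign j)
        = twistSign i * (twistSign p * twistSign p) * twistSign j by ring, twistSign_mul_self,
      mul_one, op_mul, op_mul, mul_assoc]
  F_diag i := by rw [OspTwoTwo.twist, twistSign_mul_self, one_smul, hG.E_diag, op_one]
  F_lt i j hij := by rw [OspTwoTwo.twist, hG.E_lt j i hij, op_zero, smul_zero]
  E_diag i := by rw [OspTwoTwo.twist, twistSign_mul_self, one_smul, hG.F_diag, op_one]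
  E_lt i j hij := by rw [OspTwoTwo.twist, hG.F_lt j i hij, op_zero, smul_zero]
  mul i := by simp only [Function.comp_apply, ← op_mul, hG.mul', op_one]
  mul' i := by simp only [Function.comp_apply, ← op_mul, hG.mul, op_one]

variable {R S : Type*} [CommRing R] [Ring S] [Algebra R S]

/-- The RTT relation for `A = T(u)` and `B = T(v)`, where `D`, `q` stand for `u - v` and `1`, both
multiplied by `u⁻¹ v⁻¹`. -/
structure IsRTTPair (D q : R) (A B : Matrix (Fin 4) (Fin 4) S) : Prop where
  cancel : ∀ (c : ℤ) (z : S), (D + c • q) • z = 0 → z = 0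
  rel : ∀ i j k l, (D * (D + q)) •
      (A i j * B k l - (-1 : ℤ) ^ (deg i j * deg k l) • (B k l * A i j))
    = (q * (D + q)) • ((-1 : ℤ) ^ (par i * par j + par i * par k + par j * par k) •
          (A k j * B i l - B k j * A i l))
      - (q * D) • ((if k = i.rev then
          ∑ p, ((-1 : ℤ) ^ (par i + par i * par j + par j * par p) * theta i * theta p) •
            (A p j * B p.rev l) else 0)
        - (if l = j.rev then
          ∑ p, ((-1 : ℤ) ^ (par i * par k + par j * par k + par i * par p)
              * theta j.rev * theta p.rev) • (B k p.rev * A i p) else 0))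

variable {D q : R} {A B : Matrix (Fin 4) (Fin 4) S}

set_option maxHeartbeats 1000000 in
theorem IsRTTPair.row_zero (hr : IsRTTPair D q A B) (m n : Fin 4) :
    (D * (D + q)) • (A 0 0 * B m n - B m n * A 0 0)
    = (q * (D + q)) • (A m 0 * B 0 n - B m 0 * A 0 n)
      - (q * D) • ((if m = 3 then
            A 0 0 * B 3 n + A 1 0 * B 2 n - A 2 0 * B 1 n + A 3 0 * B 0 n else 0)
        - (if n = 3 then
            B m 3 * A 0 0 - B m 2 * A 0 1 + B m 1 * A 0 2 + B m 0 * A 0 3 else 0)) := by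
  have h := hr.rel 0 0 m n
  simp only [Fin.sum_univ_four] at h
  fin_cases m <;> fin_cases n <;>
    simp [par, deg, theta, Fin.rev] at h ⊢ <;>
      linear_combination (norm := module) h

set_option maxHeartbeats 1000000 in
theorem IsRTTPair.row_one (hr : IsRTTPair D q A B) (m n : Fin 4) :
    (D * (D + q)) • (A 0 1 * B m n - (sgn m * sgn n) • (B m n * A 0 1))
    = (q * (D + q)) • (sgn m • (A m 1 * B 0 n - B m 1 * A 0 n))
      - (q * D) • ((if m = 3 then
            A 0 1 * B 3 n - A 1 1 * B 2 n + A 2 1 * B 1 n + A 3 1 * B 0 n else 0)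
        - (if n = 2 then
            sgn m • (B m 2 * A 0 1 - B m 3 * A 0 0 - B m 1 * A 0 2
              - B m 0 * A 0 3) else 0)) := by
  have h := hr.rel 0 1 m n
  simp only [Fin.sum_univ_four] at h
  fin_cases m <;> fin_cases n <;>
    simp [par, deg, theta, sgn, Fin.rev] at h ⊢ <;>
      linear_combination (norm := module) h

set_option maxHeartbeats 1000000 in
theorem IsRTTPair.row (hr : IsRTTPair D q A B) : IsRTTRow D q A B :=
  ⟨hr.cancel, hr.row_zero, hr.row_one⟩

set_option maxHeartbeats 1000000 in
theorem IsRTTPair.twist_row_zero (hr : IsRTTPair D q A B) (m n : Fin 4) :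
    (D * (D + q)) • (twist A 0 0 * twist B m n - twist B m n * twist A 0 0)
    = (q * (D + q)) • (twist A m 0 * twist B 0 n - twist B m 0 * twist A 0 n)
      - (q * D) • ((if m = 3 then
            twist A 0 0 * twist B 3 n + twist A 1 0 * twist B 2 n - twist A 2 0 * twist B 1 n + twist A 3 0 * twist B 0 n else 0)
        - (if n = 3 then
            twist B m 3 * twist A 0 0 - twist B m 2 * twist A 0 1 + twist B m 1 * twist A 0 2 + twist B m 0 * twist A 0 3 else 0)) := by
  -- Transposition exchanges m and n. The entry signs contribute an overall ε_m ε_n, so the required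
  -- identity is `h` or its negative.
  have h := congrArg op (hr.rel 0 0 n m)
  simp only [Fin.sum_univ_four] at h
  fin_cases m <;> fin_cases n <;>
    simp [par, deg, theta, twist, twistSign, Fin.rev] at h ⊢ <;>
      first
      | linear_combination (norm := module) h
      | linear_combination (norm := module) -h

set_option maxHeartbeats 1000000 in
theorem IsRTTPair.twist_row_one (hr : IsRTTPair D q A B) (m n : Fin 4) :
    (D * (D + q)) • (twist A 0 1 * twist B m n - (sgn m * sgn n) • (twist B m n * twist A 0 1))
    = (q * (D + q)) • (sgn m • (twist A m 1 * twist B 0 n - twist B m 1 * twist A 0 n))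
      - (q * D) • ((if m = 3 then
            twist A 0 1 * twist B 3 n - twist A 1 1 * twist B 2 n + twist A 2 1 * twist B 1 n + twist A 3 1 * twist B 0 n else 0)
        - (if n = 2 then
            sgn m • (twist B m 2 * twist A 0 1 - twist B m 3 * twist A 0 0 - twist B m 1 * twist A 0 2
              - twist B m 0 * twist A 0 3) else 0)) := by
  have h := congrArg op (hr.rel 1 0 n m)
  simp only [Fin.sum_univ_four] at h
  fin_cases m <;> fin_cases n <;>
    simp [par, deg, theta, sgn, twist, twistSign, Fin.rev] at h ⊢ <;>
      first
      | linear_combination (norm := module) h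
      | linear_combination (norm := module) -h

set_option maxHeartbeats 1000000 in
theorem IsRTTPair.twist_row (hr : IsRTTPair D q A B) : IsRTTRow D q (twist A) (twist B) :=
  ⟨fun c z hz => by
    have := hr.cancel c (unop z) (by rw [← unop_smul, hz, unop_zero])
    rw [← op_unop z, this, op_zero], hr.twist_row_zero, hr.twist_row_one⟩

end Twist

/-! ### The RTT relation in the Yangian, with D and q as central scalars. -/

section Yangian

section Map

variable {A A' : Type*} [Ring A] [Ring A'] (φ : A →+* A')

/-- The ring homomorphism induced on series in two variables. -/
def biMap : BiSeries A →+* BiSeries A' := PowerSeries.map (PowerSeries.map φ)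

theorem biMap_inU (g : PowerSeries A) : biMap φ (inU g) = inU (PowerSeries.map φ g) := by
  refine PowerSeries.ext fun a => ?_
  simp [biMap, inU]

theorem biMap_inV (g : PowerSeries A) : biMap φ (inV g) = inV (PowerSeries.map φ g) := by
  simp [biMap, inV]

theorem biMap_uInv : biMap φ (uInv A) = uInv A' := by simp [biMap, uInv]

theorem biMap_vInv : biMap φ (vInv A) = vInv A' := by simp [biMap, vInv]

theorem biMap_uSubV (c : ℤ) : biMap φ (uSubV A c) = uSubV A' c := by
  simp only [uSubV, map_sub, map_zsmul, map_mul, biMap_uInv, biMap_vInv]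

theorem biMap_rttLeft (M : Matrix (Fin 4) (Fin 4) (PowerSeries A)) (i j k l : Fin 4) :
    biMap φ (rttLeft M i j k l) = rttLeft (M.map (PowerSeries.map φ)) i j k l := by
  simp only [rttLeft, superBr, map_sub, map_mul, map_pow, map_neg, map_one, biMap_uSubV, biMap_inU,
    biMap_inV, Matrix.map_apply]

theorem biMap_rttRight (M : Matrix (Fin 4) (Fin 4) (PowerSeries A)) (i j k l : Fin 4) :
    biMap φ (rttRight M i j k l) = rttRight (M.map (PowerSeries.map φ)) i j k l := by
  simp only [rttRight, map_sub, map_mul, map_zsmul, biMap_uSubV, biMap_uInv, biMap_vInv,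
    apply_ite (biMap φ), map_sum, map_zero, biMap_inU, biMap_inV, Matrix.map_apply]

theorem tMat_map (g : Fin 4 → Fin 4 → ℕ → A) :
    (tMat g).map (PowerSeries.map φ) = tMat fun i j r => φ (g i j r) := by
  ext i j n
  rw [Matrix.map_apply, PowerSeries.coeff_map]
  cases n with
  | zero => simp [tMat, apply_ite φ]
  | succ n => simp [tMat]

end Map

theorem rtt (i j k l : Fin 4) : rttLeft T i j k l = rttRight T i j k l := by
  have hT : T = (tMat fun i j r => FreeAlgebra.ι ℂ (i, j, r)).map
      (PowerSeries.map (RingQuot.mkAlgHom ℂ Rel : _ →+* Yangian)) := by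
    rw [tMat_map]; rfl
  rw [hT, ← biMap_rttLeft, ← biMap_rttRight]
  refine PowerSeries.ext fun a => PowerSeries.ext fun b => ?_
  simp only [biMap, PowerSeries.coeff_map]
  exact RingQuot.mkAlgHom_rel ℂ (Rel.rtt i j k l a b)

theorem isGauss_T : IsGauss T (Matrix.of f) (Matrix.of e) h fun i => inv (h i) := by
  have hT : ∀ i j, PowerSeries.constantCoeff (T i j) = if i = j then 1 else 0 := fun i j => by
    rw [← PowerSeries.coeff_zero_eq_constantCoeff_apply]
    simp [T, tMat]
  have hc : ∀ p, PowerSeries.constantCoeff (h p) = 1 := fun p => by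
    simp [h, gaussH, (reduced_spec T hT p).1]
  exact
    { eq := T_eq
      F_diag := fun i => by simp [f, gaussF]
      F_lt := fun i j hij => by simp [f, gaussF, hij.not_gt, hij.ne]
      E_diag := fun i => by simp [e, gaussE]
      E_lt := fun i j hij => by simp [e, gaussE, hij.not_gt, hij.ne']
      mul := fun i => mul_inv_cancel_of_const (hc i)
      mul' := fun i => inv_mul_cancel_of_const (hc i) }

/-- `u⁻¹ v⁻¹` as an element of the center. -/
def qCenter (A : Type*) [Ring A] : Subring.center (BiSeries A) :=
  ⟨uInv A * vInv A, Subring.mem_center_iff.mpr fun G => by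
    rw [← mul_assoc, ← uInv_mul_comm, mul_assoc, ← vInv_mul_comm, mul_assoc]⟩

/-- `u - v`, multiplied by `u⁻¹ v⁻¹`, as an element of the center. -/
def dCenter (A : Type*) [Ring A] : Subring.center (BiSeries A) :=
  ⟨uSubV A 0, Subring.mem_center_iff.mpr fun G => by
    rw [uSubV, zero_smul, sub_zero, mul_sub, sub_mul, uInv_mul_comm, vInv_mul_comm]⟩

theorem qCenter_smul {A : Type*} [Ring A] (G : BiSeries A) :
    qCenter A • G = uInv A * vInv A * G := rfl

theorem dCenter_add_smul {A : Type*} [Ring A] (c : ℤ) (G : BiSeries A) :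
    (dCenter A + c • qCenter A) • G = uSubV A (-c) * G := by
  rw [add_smul, smul_assoc, qCenter_smul, show dCenter A • G = uSubV A 0 * G from rfl]
  simp only [uSubV, neg_smul, zero_smul, sub_zero, sub_neg_eq_add, add_mul, smul_mul_assoc]

theorem isRTTPair_T : IsRTTPair (dCenter Yangian) (qCenter Yangian)
    (T.map (inUHom Yangian)) (T.map (inVHom Yangian)) where
  cancel c z hz := uSubV_mul_eq_zero ((dCenter_add_smul c z).symm.trans hz)
  rel i j k l := by
    have h := rtt i j k l
    have d0 : ∀ G, uSubV Yangian 0 * G = dCenter Yangian • G := fun G => rfl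
    have d1 : ∀ G, uSubV Yangian kappa * G = (dCenter Yangian + qCenter Yangian) • G := fun G => by
      have := dCenter_add_smul (A := Yangian) 1 G
      rw [one_smul] at this
      exact this.symm
    have hs : ∀ (n : ℕ) (G : BiSeries Yangian), (-1) ^ n * G = (-1 : ℤ) ^ n • G := fun n G => by
      rw [zsmul_eq_mul]; simp
    simp only [rttLeft, rttRight, superBr, mul_assoc (uSubV Yangian 0),
      mul_assoc (uInv Yangian * vInv Yangian)] at h
    simp only [← qCenter_smul, d0, d1, hs] at h
    simp only [mul_smul (dCenter Yangian), mul_smul (qCenter Yangian), Matrix.map_apply, ← inU_eq_inUHom, ← inV_eq_inVHom]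
    exact h

end Yangian

/-! ### Specialization, exchange of variables and the individual relations. -/

section Conclusion

/-- At u = v - 1 the left side vanishes, while u - v becomes -1 on the right, so ρ is killed by a
product of non-zero-divisors. -/
theorem eq_zero_of_smul_eq {A : Type*} [Ring A] (ρ : PowerSeries A) (L : BiSeries A)
    (hL : (dCenter A + qCenter A) • L = (qCenter A * dCenter A) • inV ρ) : ρ = 0 := by
  have h1 := dCenter_add_smul 1 L
  rw [one_smul, hL, mul_smul, qCenter_smul] at h1
  have h2 := spec_eq_zero h1.symm
  have h3 : dCenter A • inV ρ = uSubV A (-1) * inV ρ - uInv A * (vInv A * inV ρ) := by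
    have h4 := dCenter_add_smul 1 (inV ρ)
    rw [one_smul, add_smul, qCenter_smul, mul_assoc] at h4
    rw [← h4, add_sub_cancel_right]
  rw [h3, map_sub, spec_uSubV_mul, zero_sub, neg_eq_zero, spec_uInv_mul, spec_vInv_mul,
    spec_inV] at h2
  exact X_mul_eq_zero (shiftInv_mul_eq_zero h2)

theorem dCenter_add_two_smul {A : Type*} [Ring A] (G : BiSeries A) :
    (dCenter A + 2 * qCenter A) • G = uSubV A (-2) * G := by
  rw [← dCenter_add_smul, two_mul, two_smul]

theorem superBr_of_even {A : Type*} [Ring A] {p r : ℕ} (hpr : Even (p * r)) (x y : BiSeries A) :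
    superBr p r x y = x * y - y * x := by
  rw [superBr, hpr.neg_one_pow, one_mul]

/-- The brackets of h_3 are found with h_3 at v and the other series at u. Exchanging the variables
turns u - v + c into -(u - v - c), and the sign reverses the commutator. -/
theorem uSubV_mul_swap {A : Type*} [Ring A] {c : ℤ} {x y z : BiSeries A}
    (hz : uSubV A (-c) * (x * y - y * x) = uInv A * vInv A * z) :
    uSubV A c * (swap A y * swap A x - swap A x * swap A y)
      = uInv A * vInv A * swap A z := by
  have h := congrArg (swap A) hz
  rw [map_mul, map_mul, map_mul, map_sub, map_mul, map_mul, swap_uInv, swap_vInv, swap_uSubV,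
    neg_neg, neg_mul, ← mul_neg, neg_sub, ← uInv_mul_comm] at h
  exact h

theorem uSubV_mul_swap_left {A : Type*} [Ring A] {c : ℤ} {x y z : BiSeries A}
    (hz : uSubV A (-c) * (y * x - x * y) = uInv A * vInv A * (y * (x - z))) :
    uSubV A c * (swap A y * swap A x - swap A x * swap A y)
      = uInv A * vInv A * (swap A y * (swap A z - swap A x)) := by
  rw [← map_sub, ← map_mul (swap A) y (z - x)]
  refine uSubV_mul_swap ?_
  rw [← neg_sub (y * x), mul_neg, hz, ← mul_neg, ← mul_neg, neg_sub]

theorem smul_sub_comm {R S : Type*} [Ring R] [AddCommGroup S] [Module R S] {c d : R}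
    {x y z w z' w' : S} (h : c • (x - y) = d • (z - w - z' + w')) :
    c • (y - x) = d • (w - z + z' - w') := by
  rw [← neg_sub x, smul_neg, h, ← smul_neg]
  congr 1
  abel

theorem two_mul_dCenter_smul {A : Type*} [Ring A] {X Z : BiSeries A}
    (hX : dCenter A • X = (2 * qCenter A) • Z) : IsQuot 0 X (2 * Z) := by
  rw [mul_comm, mul_smul, qCenter_smul, two_smul, ← two_mul] at hX
  exact hX

theorem row_T : IsRTTRow (dCenter Yangian) (qCenter Yangian)
    (T.map (inUHom Yangian)) (T.map (inVHom Yangian)) := isRTTPair_T.row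

theorem row_twist_T : IsRTTRow (dCenter Yangian) (qCenter Yangian)
    ((twist T).map (RingHom.op (inUHom Yangian))) ((twist T).map (RingHom.op (inVHom Yangian))) := by
  rw [twist_map, twist_map]
  exact isRTTPair_T.twist_row

theorem twist_apply_of_lt {P : Type*} [Ring P] (M : Matrix (Fin 4) (Fin 4) P) {i j : Fin 4}
    (hi : i < 3) (hj : j < 3) : twist M i j = MulOpposite.op (M j i) := by
  have : twistSign i * twistSign j = 1 := by revert i j; decide
  rw [twist, this, one_smul]

theorem bracket_h_one_e : inU (h 0) * inV (e 1 2) - inV (e 1 2) * inU (h 0) = 0 :=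
  sub_eq_zero.mpr (row_T.commute_E (isGauss_T.map _) (isGauss_T.map _)).eq

theorem bracket_h_one_f : inU (h 0) * inV (f 2 1) - inV (f 2 1) * inU (h 0) = 0 :=
  sub_eq_zero.mpr (row_T.commute_F (isGauss_T.map _) (isGauss_T.map _)).eq

theorem bracket_h_one_h_three : inU (h 0) * inV (h 2) - inV (h 2) * inU (h 0) = 0 :=
  sub_eq_zero.mpr (row_T.commute_H_two (isGauss_T.map _) (isGauss_T.map _)).eq

theorem bracket_e_f : inU (e 0 1) * inV (f 2 1) - inV (f 2 1) * inU (e 0 1) = 0 :=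
  row_T.bracket_E_F isGauss_T

/-- Over the opposite algebra the twist puts f_21, e_23 in the places of e_12, f_32, so this is
`bracket_E_F` for the twisted matrix with u and v exchanged. -/
theorem bracket_f_e : inU (e 1 2) * inV (f 1 0) - inV (f 1 0) * inU (e 1 2) = 0 := by
  have h1 := congrArg MulOpposite.unop (row_twist_T.bracket_E_F isGauss_T.twist)
  rw [twist_apply_of_lt _ (by decide) (by decide), twist_apply_of_lt _ (by decide) (by decide)]
    at h1
  have h2 : inV (e 1 2) * inU (f 1 0) - inU (f 1 0) * inV (e 1 2) = 0 := h1
  simpa using congrArg (swap Yangian) h2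

theorem bracket_e_e : dCenter Yangian • (inU (e 0 1) * inV (e 1 2) - inV (e 1 2) * inU (e 0 1))
    = (2 * qCenter Yangian) • (inU (e 0 2) - inV (e 0 2) - inU (e 0 1) * inV (e 1 2)
        + inV (e 0 1) * inV (e 1 2)) :=
  row_T.bracket_E_E isGauss_T eq_zero_of_smul_eq

theorem bracket_f_f : dCenter Yangian • (inU (f 1 0) * inV (f 2 1) - inV (f 2 1) * inU (f 1 0))
    = (2 * qCenter Yangian) • (inV (f 2 0) - inU (f 2 0) + inV (f 2 1) * inU (f 1 0)
        - inV (f 2 1) * inV (f 1 0)) := by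
  have h1 := congrArg MulOpposite.unop (row_twist_T.bracket_E_E isGauss_T.twist fun ρ L hL =>
    MulOpposite.unop_injective (eq_zero_of_smul_eq (MulOpposite.unop ρ) (MulOpposite.unop L)
      (congrArg MulOpposite.unop hL)))
  rw [twist_apply_of_lt _ (by decide) (by decide), twist_apply_of_lt _ (by decide) (by decide),
    twist_apply_of_lt _ (by decide) (by decide)] at h1
  have h2 : dCenter Yangian • (inV (f 2 1) * inU (f 1 0) - inU (f 1 0) * inV (f 2 1))
      = (2 * qCenter Yangian) • (inU (f 2 0) - inV (f 2 0) - inV (f 2 1) * inU (f 1 0)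
          + inV (f 2 1) * inV (f 1 0)) := h1
  exact smul_sub_comm h2

theorem bracket_h_e : uSubV Yangian 2 * (inU (h 2) * inV (e 0 1) - inV (e 0 1) * inU (h 2))
    = uInv Yangian * vInv Yangian * (inU (h 2) * (inU (shift 2 (e 0 1)) - inV (e 0 1))) := by
  obtain ⟨t, ht⟩ := row_T.exists_bracket_H_E isGauss_T
  rw [dCenter_add_two_smul, qCenter_smul] at ht
  change uSubV Yangian (-2) * (inV (h 2) * inU (e 0 1) - inU (e 0 1) * inV (h 2))
    = uInv Yangian * vInv Yangian * (inV (h 2) * (inU (e 0 1) - inV t)) at ht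
  have hinv : inV (inv (h 2)) * inV (h 2) = 1 := by
    rw [inV_eq_inVHom, inV_eq_inVHom, ← map_mul, isGauss_T.mul' 2, map_one]
  -- After cancelling h_3(v) on the left, the right side e_12(u) - t(v) is divisible by u - v + 2.
  -- Hence it vanishes at u = v - 2.
  have hs : shift 2 (e 0 1) = t := by
    have h1 : uSubV Yangian (-2) * (inV (inv (h 2)) *
        (inV (h 2) * inU (e 0 1) - inU (e 0 1) * inV (h 2)))
        = uInv Yangian * vInv Yangian * (inU (e 0 1) - inV t) := by
      rw [← dCenter_add_two_smul, ← mul_smul_comm, dCenter_add_two_smul, ht, ← qCenter_smul,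
        mul_smul_comm, ← mul_assoc, hinv, one_mul, qCenter_smul]
    have h2 := spec_eq_zero h1
    rwa [map_sub, spec_inU, spec_inV, sub_eq_zero] at h2
  have h3 := uSubV_mul_swap_left (c := 2) ht
  rw [swap_inU, swap_inV, swap_inV] at h3
  rw [hs]
  exact h3

theorem bracket_h_f : uSubV Yangian 2 * (inU (h 2) * inV (f 1 0) - inV (f 1 0) * inU (h 2))
    = uInv Yangian * vInv Yangian * ((inV (f 1 0) - inU (shift 2 (f 1 0))) * inU (h 2)) := by
  obtain ⟨t, ht⟩ := row_twist_T.exists_bracket_H_E isGauss_T.twist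
  rw [twist_apply_of_lt _ (by decide) (by decide)] at ht
  replace ht := congrArg MulOpposite.unop ht
  change (dCenter Yangian + 2 * qCenter Yangian) •
      (inU (f 1 0) * inV (h 2) - inV (h 2) * inU (f 1 0))
    = qCenter Yangian • ((inU (f 1 0) - inV t.unop) * inV (h 2)) at ht
  rw [dCenter_add_two_smul, qCenter_smul] at ht
  have hinv : inV (h 2) * inV (inv (h 2)) = 1 := by
    rw [inV_eq_inVHom, inV_eq_inVHom, ← map_mul, isGauss_T.mul 2, map_one]
  -- The same specialization, with h_3(v) now cancelled on the right because the product was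
  -- reversed in the opposite algebra.
  have hs : shift 2 (f 1 0) = t.unop := by
    have h1 : uSubV Yangian (-2) * ((inU (f 1 0) * inV (h 2) - inV (h 2) * inU (f 1 0))
          * inV (inv (h 2)))
        = uInv Yangian * vInv Yangian * (inU (f 1 0) - inV t.unop) := by
      rw [← mul_assoc, ht, mul_assoc, mul_assoc (_ - _), hinv, mul_one]
    have h2 := spec_eq_zero h1
    rwa [map_sub, spec_inU, spec_inV, sub_eq_zero] at h2
  have h3 := uSubV_mul_swap (c := 2) ht
  rw [map_mul, map_sub, swap_inU, swap_inV, swap_inV] at h3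
  rw [hs]
  exact h3

end Conclusion

end OspTwoTwo

end

theorem proposition5p12 :
    -- `[h_1(u), h_3(v)] = 0`
    superBr (deg 0 0) (deg 2 2) (inU (h 0)) (inV (h 2)) = 0 ∧
    -- `[h_3(u), e_12(v)] = h_3(u) (e_12(u-2) - e_12(v)) / (u-v-2)`
    IsQuot 2 (superBr (deg 2 2) (deg 0 1) (inU (h 2)) (inV (e 0 1)))
      (inU (h 2) * (inU (shift 2 (e 0 1)) - inV (e 0 1))) ∧
    -- `[h_3(u), f_21(v)] = (f_21(v) - f_21(u-2)) h_3(u) / (u-v-2)`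
    IsQuot 2 (superBr (deg 2 2) (deg 1 0) (inU (h 2)) (inV (f 1 0)))
      ((inV (f 1 0) - inU (shift 2 (f 1 0))) * inU (h 2)) ∧
    -- `[h_1(u), e_23(v)] = 0` and `[h_1(u), f_32(v)] = 0`
    superBr (deg 0 0) (deg 1 2) (inU (h 0)) (inV (e 1 2)) = 0 ∧
    superBr (deg 0 0) (deg 2 1) (inU (h 0)) (inV (f 2 1)) = 0 ∧
    -- `[e_12(u), f_32(v)] = 0` and `[e_23(u), f_21(v)] = 0`
    superBr (deg 0 1) (deg 2 1) (inU (e 0 1)) (inV (f 2 1)) = 0 ∧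
    superBr (deg 1 2) (deg 1 0) (inU (e 1 2)) (inV (f 1 0)) = 0 ∧
    -- `[e_12(u), e_23(v)] = 2 (e_13(u) - e_13(v) - e_12(u) e_23(v) + e_12(v) e_23(v)) / (u-v)`
    IsQuot 0 (superBr (deg 0 1) (deg 1 2) (inU (e 0 1)) (inV (e 1 2)))
      (2 * (inU (e 0 2) - inV (e 0 2) - inU (e 0 1) * inV (e 1 2)
        + inV (e 0 1) * inV (e 1 2))) ∧
    -- `[f_21(u), f_32(v)] = 2 (f_31(v) - f_31(u) + f_32(v) f_21(u) - f_32(v) f_21(v)) / (u-v)`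
    IsQuot 0 (superBr (deg 1 0) (deg 2 1) (inU (f 1 0)) (inV (f 2 1)))
      (2 * (inV (f 2 0) - inU (f 2 0) + inV (f 2 1) * inU (f 1 0)
        - inV (f 2 1) * inV (f 1 0))) := by
  refine ⟨?_, ?_, ?_, ?_, ?_, ?_, ?_, ?_, ?_⟩
  · rw [superBr_of_even (by decide)]
    exact bracket_h_one_h_three
  · rw [superBr_of_even (by decide)]
    exact bracket_h_e
  · rw [superBr_of_even (by decide)]
    exact bracket_h_f
  · rw [superBr_of_even (by decide)]
    exact bracket_h_one_e
  · rw [superBr_of_even (by decide)]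
    exact bracket_h_one_f
  · rw [superBr_of_even (by decide)]
    exact bracket_e_f
  · rw [superBr_of_even (by decide)]
    exact bracket_f_e
  · rw [superBr_of_even (by decide)]
    exact two_mul_dCenter_smul bracket_e_e
  · rw [superBr_of_even (by decide)]
    exact two_mul_dCenter_smul bracket_f_f
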